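/- Let $\mathcal H$ be a separable complex Hilbert space. For a compact operator $K$ on $\mathcal H$ let $s_1(K)\ge s_2(K)\ge\dots>0$ be its nonzero singular values, i.e. the square roots of the nonzero eigenvalues of $K^*K$, repeated according to multiplicity; for $p\ge 1$ put $\|K\|_p=\big(\sum_k s_k(K)^p\big)^{1/p}$, and let $\mathcal L^p$ be the set of compact $K$ with $\|K\|_p<\infty$. For an operator $A$ with resolvent set $\rho(A)$, write $R_A(z)=(A-z)^{-1}$ for $z\in\rho(A)$. For $0<\theta\le\pi/2$ let $S_\theta=\{z\in\mathbb C:\ \operatorname{Re}z>0,\ |\arg z|<\theta\}$, and for $\gamma\in\mathbb R$ and $0\le\alpha<\pi$ let $\overline S_{\alpha,\gamma}=\{\gamma\}\cup\{z\ne\gamma:\ |\arg(z-\gamma)|\le\alpha\}$, $\overline S_\alpha=\overline S_{\alpha,0}$. For $\theta\in(0,\pi/2]$ and $\omega_0\in\mathbb R$, the class $\mathscr H(\theta,\omega_0)$ consists of the closed operators $A$ on $\mathcal H$ such that (a) $\rho(A)\supseteq\mathbb C\setminus\overline S_{\pi/2-\theta,\,-\omega_0}$, and (b) for every $\varepsilon\in(0,\theta)$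 there is $M_\varepsilon>0$ with $\|(z+A)^{-1}\|\le M_\varepsilon\,|z-\omega_0|^{-1}$ for all $z\in\overline S_{\pi/2+(\theta-\varepsilon),\,\omega_0}\setminus\{\omega_0\}$. A quasi-bounded holomorphic semigroup of semi-angle $\theta$ is a family $\{U(z)\}_{z\in S_\theta\cup\{0\}}$ of bounded operators on $\mathcal H$ with $U(0)=1$, holomorphic in operator norm on $S_\theta$, with $U(z+w)=U(z)U(w)$ for $z,w\in S_\theta$, and such that for every $0<\theta'<\theta$: $U(z)x\to x$ as $z\to0$ in $\overline S_{\theta'}$ for each $x\in\mathcal H$, and there are $M_{\theta'}\ge1$, $\omega_{\theta'}\in\mathbb R$ with $\|U(z)\|\le M_{\theta'}e^{\omega_{\theta'}|z|}$ on $\overline S_{\theta'}$. It is called Gibbs if $U(z)\in\mathcal L^1$ for all $z\in S_\theta$. **Theorem.** Let $\theta\in(0,\pi/2]$, $\omega_0\in\mathbb R$, $p\ge1$ real, and let $\{e^{-tA}\}_{t\ge0}$ be a $C_0$-semigroup on $\mathcal H$ with generator $A\in\mathscr H(\theta,\omega_0)$ (so $Ax=\lim_{t\downarrow0}t^{-1}(x-e^{-tA}x)$,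 with $\operatorname{dom}A$ the set of $x$ for which this limit exists). Suppose that $R_A(z)\in\mathcal L^p$ for some (equivalently, for every) $z\in\rho(A)$. Then $\{e^{-tA}\}_{t\ge0}$ extends to a quasi-bounded holomorphic Gibbs semigroup $\{e^{-zA}\}_{z\in S_\theta\cup\{0\}}$ of semi-angle $\theta$, and for every $\theta'\in(0,\theta)$ $$\|e^{-zA}\|_1=O(|z|^{-p})\qquad\text{as } z\to0,\ z\in\overline S_{\theta'}\setminus\{0\}.$$ -/

import Mathlib

open Filter Topology Asymptotics
open scoped ENNReal

namespace GibbsSemigroup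

noncomputable section

/-- The open sector `S_θ` with vertex `0` and semi-angle `θ ∈ (0, π/2]`. -/
def openSector (θ : ℝ) : Set ℂ :=
  {z | 0 < z.re ∧ |z.arg| < θ}

/-- The closed sector with vertex `γ ∈ ℝ` and semi-angle `α ∈ [0, π)`. It contains its vertex, since
`Complex.arg 0 = 0`. For `0 < α ≤ π / 2` it is the closure of the open sector of semi-angle `α`
with vertex `γ`; for `α = 0` it is the half-line `[γ, ∞)`. -/
def closedSector (α γ : ℝ) : Set ℂ :=
  {z | |(z - (γ : ℂ)).arg| ≤ α}

variable {H : Type*} [NormedAddCommGroup H] [InnerProductSpace ℂ H]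

/-- `R` is the resolvent `R_A(z) = (A - z)⁻¹` of the unbounded operator `A` at `z`: an everywhere
defined bounded operator which is a two-sided inverse of `A - z : dom A → H`. -/
structure IsResolventAt (A : H →ₗ.[ℂ] H) (z : ℂ) (R : H →L[ℂ] H) : Prop where
  mem_domain : ∀ x : H, R x ∈ A.domain
  right_inv : ∀ x : H, A ⟨R x, mem_domain x⟩ - z • R x = x
  left_inv : ∀ x : A.domain, R (A x - z • (x : H)) = x

/-- The resolvent set `ρ(A)` of an unbounded operator. -/
def resolventSet (A : H →ₗ.[ℂ] H) : Set ℂ :=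
  {z | ∃ R : H →L[ℂ] H, IsResolventAt A z R}

/-- The class `ℋ(θ, ω₀)` of closed operators. -/
structure HolomorphicClass (θ ω₀ : ℝ) (A : H →ₗ.[ℂ] H) : Prop where
  isClosed : A.IsClosed
  subset_resolventSet : (closedSector (Real.pi / 2 - θ) (-ω₀))ᶜ ⊆ resolventSet A
  resolvent_bound : ∀ ε : ℝ, 0 < ε → ε < θ → ∃ M : ℝ, 0 < M ∧
    ∀ z ∈ closedSector (Real.pi / 2 + (θ - ε)) ω₀, z ≠ (ω₀ : ℂ) →
      ∃ R : H →L[ℂ] H, IsResolventAt A (-z) R ∧ ‖R‖ ≤ M * ‖z - (ω₀ : ℂ)‖⁻¹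

/-- A `C₀`-semigroup `{T(t)}_{t ≥ 0}` of bounded operators (values at `t < 0` are irrelevant). -/
structure IsC0Semigroup (T : ℝ → H →L[ℂ] H) : Prop where
  map_zero : T 0 = 1
  map_add : ∀ s t : ℝ, 0 ≤ s → 0 ≤ t → T (s + t) = T s * T t
  tendsto_zero : ∀ x : H, Tendsto (fun t : ℝ => T t x) (𝓝[>] 0) (𝓝 x)

/-- `A` is the generator of `T` with the sign convention `T(t) = e^{-tA}`: the domain of `A` is the
set of all `x` for which `lim_{t ↓ 0} t⁻¹ (x - T(t) x)` exists, and `A x` is this limit. -/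
def IsGenerator (A : H →ₗ.[ℂ] H) (T : ℝ → H →L[ℂ] H) : Prop :=
  ∀ x y : H, (x, y) ∈ A.graph ↔
    Tendsto (fun t : ℝ => ((t⁻¹ : ℝ) : ℂ) • (x - T t x)) (𝓝[>] 0) (𝓝 y)

/-- A quasi-bounded holomorphic semigroup `{U(z)}_{z ∈ S_θ ∪ {0}}` of semi-angle `θ`
(values of `U` outside `S_θ ∪ {0}` are irrelevant). -/
structure IsQuasiBoundedHolomorphicSemigroup (θ : ℝ) (U : ℂ → H →L[ℂ] H) : Prop where
  map_zero : U 0 = 1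
  holomorphic : DifferentiableOn ℂ U (openSector θ)
  map_add : ∀ z ∈ openSector θ, ∀ w ∈ openSector θ, U (z + w) = U z * U w
  tendsto_zero : ∀ θ' : ℝ, 0 < θ' → θ' < θ → ∀ x : H,
    Tendsto (fun z : ℂ => U z x) (𝓝[closedSector θ' 0] 0) (𝓝 x)
  quasiBounded : ∀ θ' : ℝ, 0 < θ' → θ' < θ → ∃ M ω : ℝ, 1 ≤ M ∧
    ∀ z ∈ closedSector θ' 0, ‖U z‖ ≤ M * Real.exp (ω * ‖z‖)

variable [CompleteSpace H]

/-- `∑ₖ sₖ(K) ^ p` for a compact operator `K`, where the `sₖ(K)` are the nonzero singular values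
of `K`, i.e. the square roots of the nonzero eigenvalues of `K* K`, repeated according to
multiplicity. Equal terms are collected: the sum is over all reals `s > 0`, and `s ^ p` is counted
as often as the multiplicity (zero if `s ^ 2` is not an eigenvalue) of `s ^ 2` as an eigenvalue of
`K* K`, which is finite since `K` is compact. -/
def schattenSum (p : ℝ) (K : H →L[ℂ] H) : ℝ≥0∞ :=
  ∑' s : Set.Ioi (0 : ℝ),
    (Module.finrank ℂ (Module.End.eigenspace
      ((ContinuousLinearMap.adjoint K * K : H →L[ℂ] H) : H →ₗ[ℂ] H)
      ((((s : ℝ) ^ 2 : ℝ)) : ℂ)) : ℝ≥0∞) * ENNReal.ofReal ((s : ℝ) ^ p)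

/-- Membership in the von Neumann–Schatten class `ℒ^p`. -/
def MemSchatten (p : ℝ) (K : H →L[ℂ] H) : Prop :=
  IsCompactOperator K ∧ schattenSum p K < ∞

/-- The Schatten norm `‖K‖_p = (∑ₖ sₖ(K) ^ p) ^ (1 / p)` of `K ∈ ℒ^p`. -/
def schattenNorm (p : ℝ) (K : H →L[ℂ] H) : ℝ :=
  (schattenSum p K).toReal ^ (1 / p)

/-- A quasi-bounded holomorphic semigroup is a holomorphic Gibbs semigroup if all its elements
`U(z)`, `z ∈ S_θ`, are of trace class. -/
structure IsHolomorphicGibbsSemigroup (θ : ℝ) (U : ℂ → H →L[ℂ] H) : Prop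
    extends IsQuasiBoundedHolomorphicSemigroup θ U where
  traceClass : ∀ z ∈ openSector θ, MemSchatten 1 (U z)

end

end GibbsSemigroup

/-!
# Holomorphic Gibbs semigroups from resolvents in a Schatten class

**The holomorphic extension.** Put `G(w) = (w + ω₀ + A)⁻¹`, so that `w G(w)` is bounded on every
smaller sector `|arg w| < π / 2 + θ - δ`. The semigroup is
`exp(-z A) = exp(ω₀ z) (2πi)⁻¹ ∫ exp(λ z) G(λ) dλ` over a Hankel contour. After the substitution
`λ = u / z` the contour no longer depends on `z`, so that the bound `C exp(|ω₀| |z|)` for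
`exp(-z A)` and the bound `O(1 / |z|)` for its derivative as `z → 0` need no deformation of
contours. The contour consists of two rays starting at `1`; its directions depend on `δ`, and the
integral is only used for `|arg z| < θ - 2 δ`.

The integral solves `U' = -A U` (`hasDerivAt_dunfordIntegral`, an integration by parts, and
`mul_sub_dunfordDeriv`) and tends to `1` on the range of the resolvent
(`norm_dunfordIntegral_mul_sub_le`, where the normalization is Hankel's integral
`hankelIntegral_exp_div`). Uniqueness for the Cauchy problem
(`IsGenerator.eq_of_hasDerivAt`) identifies it with the given semigroup on `(0, ∞)`. The identity
theorem then shows that the integrals for different `δ` agree, and it carries the semigroup law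
from `(0, ∞)` to the sector.

**The trace norm.** The nonzero singular values of a compact operator are its nonzero approximation
numbers `a_k(K) = inf {‖K - F‖ : rank F ≤ k}` (`schattenSum_eq_tsum_approxNumber`), for which
`a_{m + n}(A B) ≤ a_m(A) a_n(B)` is immediate. Let `n = ⌈p⌉` and `μ = max 1 (1 / |z|)`. The equation
`U' = -A U` gives `exp(-(z / n) A) = G(μ) L` with `‖L‖ = O(μ)`, so `exp(-z A) = (G(μ) L)ⁿ` and
`a_{nk}(exp(-z A)) ≤ a_k(G(μ))ⁿ ‖L‖ⁿ`. As `a_k(G(μ)) ≤ ‖G(μ)‖ = O(1 / μ)` and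
`a_k(G(μ)) = O(a_k(R))` for the given resolvent `R ∈ ℒ^p`, this is
`O(a_k(R)^p μ^{-(n - p)} μⁿ) = O(a_k(R)^p μ^p)`, and summing over `k` gives the claim.
-/

namespace GibbsSemigroup

noncomputable section

section

variable {H : Type*} [NormedAddCommGroup H] [InnerProductSpace ℂ H]

/-! ### Approximation numbers -/

/-- The `k`-th approximation number of a bounded operator: its distance in operator norm to the
operators of rank at most `k`. The index starts at `0`, so that `approxNumber K 0 = ‖K‖`. -/
def approxNumber (K : H →L[ℂ] H) (k : ℕ) : ℝ :=
  ⨅ F : {F : H →L[ℂ] H // (F : H →ₗ[ℂ] H).rank ≤ k}, ‖K - F‖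

instance (k : ℕ) : Nonempty {F : H →L[ℂ] H // (F : H →ₗ[ℂ] H).rank ≤ k} :=
  ⟨⟨0, by simp⟩⟩

lemma approxNumber_nonneg (K : H →L[ℂ] H) (k : ℕ) : 0 ≤ approxNumber K k :=
  Real.iInf_nonneg fun _ => norm_nonneg _

lemma approxNumber_le_norm_sub (K : H →L[ℂ] H) {k : ℕ} {F : H →L[ℂ] H}
    (hF : (F : H →ₗ[ℂ] H).rank ≤ k) : approxNumber K k ≤ ‖K - F‖ :=
  ciInf_le (f := fun F : {F : H →L[ℂ] H // (F : H →ₗ[ℂ] H).rank ≤ k} => ‖K - F‖)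
    ⟨0, by rintro _ ⟨F, rfl⟩; exact norm_nonneg _⟩ ⟨F, hF⟩

lemma le_approxNumber {K : H →L[ℂ] H} {k : ℕ} {r : ℝ}
    (h : ∀ F : H →L[ℂ] H, (F : H →ₗ[ℂ] H).rank ≤ k → r ≤ ‖K - F‖) : r ≤ approxNumber K k :=
  le_ciInf fun F => h F.1 F.2

lemma approxNumber_le_norm (K : H →L[ℂ] H) (k : ℕ) : approxNumber K k ≤ ‖K‖ := by
  simpa using approxNumber_le_norm_sub K (k := k) (F := 0) (by simp)

lemma approxNumber_antitone (K : H →L[ℂ] H) : Antitone (approxNumber K) := fun _ _ hmn =>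
  le_approxNumber fun _ hF => approxNumber_le_norm_sub K (hF.trans (by exact_mod_cast hmn))

lemma approxNumber_mul_le (A B : H →L[ℂ] H) (m n : ℕ) :
    approxNumber (A * B) (m + n) ≤ approxNumber A m * approxNumber B n := by
  have key : ∀ F G : H →L[ℂ] H, (F : H →ₗ[ℂ] H).rank ≤ m → (G : H →ₗ[ℂ] H).rank ≤ n →
      approxNumber (A * B) (m + n) ≤ ‖A - F‖ * ‖B - G‖ := by
    intro F G hF hG
    -- the operator `F (B - G) + A G` has rank at most `m + n` and differs from `A B` by
    -- `(A - F) (B - G)`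
    have hrank : ((F * (B - G) + A * G : H →L[ℂ] H) : H →ₗ[ℂ] H).rank ≤
        ((m + n : ℕ) : Cardinal) := by
      have h1 := LinearMap.rank_comp_le_left ((B - G : H →L[ℂ] H) : H →ₗ[ℂ] H)
        (F : H →ₗ[ℂ] H)
      have h2 := LinearMap.rank_comp_le_right (G : H →ₗ[ℂ] H) (A : H →ₗ[ℂ] H)
      push_cast
      exact (LinearMap.rank_add_le _ _).trans (add_le_add (h1.trans hF) (h2.trans hG))
    have h : A * B - (F * (B - G) + A * G) = (A - F) * (B - G) := by noncomm_ring
    calc _ ≤ ‖A * B - (F * (B - G) + A * G)‖ := approxNumber_le_norm_sub _ hrank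
      _ = ‖(A - F) * (B - G)‖ := by rw [h]
      _ ≤ _ := norm_mul_le _ _
  rw [approxNumber.eq_1 A, Real.iInf_mul_of_nonneg (approxNumber_nonneg _ _)]
  refine le_ciInf fun F => ?_
  rw [approxNumber.eq_1 B, Real.mul_iInf_of_nonneg (norm_nonneg _)]
  exact le_ciInf fun G => key F.1 G.1 F.2 G.2

lemma approxNumber_mul_le_norm_mul (A B : H →L[ℂ] H) (k : ℕ) :
    approxNumber (A * B) k ≤ ‖A‖ * approxNumber B k := by
  have := approxNumber_mul_le A B 0 k
  rw [zero_add] at this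
  exact this.trans (mul_le_mul_of_nonneg_right (approxNumber_le_norm _ _) (approxNumber_nonneg _ _))

lemma approxNumber_mul_le_mul_norm (A B : H →L[ℂ] H) (k : ℕ) :
    approxNumber (A * B) k ≤ approxNumber A k * ‖B‖ :=
  (approxNumber_mul_le A B k 0).trans
    (mul_le_mul_of_nonneg_left (approxNumber_le_norm _ _) (approxNumber_nonneg _ _))

lemma approxNumber_pow_le (K : H →L[ℂ] H) (n k : ℕ) :
    approxNumber (K ^ n) (n * k) ≤ approxNumber K k ^ n := by
  induction n with
  | zero =>
    rw [pow_zero, pow_zero]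
    exact (approxNumber_le_norm _ _).trans ContinuousLinearMap.norm_id_le
  | succ n ih =>
    rw [pow_succ, pow_succ, Nat.succ_mul]
    exact (approxNumber_mul_le _ _ _ _).trans
      (mul_le_mul_of_nonneg_right ih (approxNumber_nonneg _ _))

/-! ### Singular values and approximation numbers -/

/-- Layer-cake comparison of two sums of `p`-th powers. -/
lemma tsum_rpow_le_of_encard_le {ι κ : Type*} {f : ι → ℝ} {g : κ → ℝ} (hf : ∀ i, 0 ≤ f i)
    (hg : ∀ i, 0 ≤ g i) {p : ℝ} (hp : 0 < p)
    (h : ∀ t : ℝ, 0 < t → {i | t < f i}.encard ≤ {i | t < g i}.encard) :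
    ∑' i, ENNReal.ofReal (f i ^ p) ≤ ∑' i, ENNReal.ofReal (g i ^ p) := by
  let _ : MeasurableSpace ι := ⊤
  let _ : MeasurableSpace κ := ⊤
  rw [← MeasureTheory.lintegral_count, ← MeasureTheory.lintegral_count,
    MeasureTheory.lintegral_rpow_eq_lintegral_meas_lt_mul _ (MeasureTheory.ae_of_all _ hf)
      measurable_from_top.aemeasurable hp,
    MeasureTheory.lintegral_rpow_eq_lintegral_meas_lt_mul _ (MeasureTheory.ae_of_all _ hg)
      measurable_from_top.aemeasurable hp]
  gcongr ENNReal.ofReal p * ?_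
  refine MeasureTheory.setLIntegral_mono' measurableSet_Ioi fun t ht => ?_
  gcongr
  rw [MeasureTheory.Measure.count_apply MeasurableSpace.measurableSet_top,
    MeasureTheory.Measure.count_apply MeasurableSpace.measurableSet_top]
  exact_mod_cast h t ht

variable [CompleteSpace H]

/-- The eigenspace of `K* K` for the eigenvalue `s ^ 2`. -/
abbrev singularSpace (K : H →L[ℂ] H) (s : ℝ) : Submodule ℂ H :=
  Module.End.eigenspace ((ContinuousLinearMap.adjoint K * K : H →L[ℂ] H) : H →ₗ[ℂ] H)
    (((s ^ 2 : ℝ)) : ℂ)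

/-- The index set of the nonzero singular values of `K`, counted with multiplicity. -/
abbrev SingularIndex (K : H →L[ℂ] H) : Type :=
  Σ s : Set.Ioi (0 : ℝ), Fin (Module.finrank ℂ (singularSpace K s))

lemma schattenSum_eq_tsum (p : ℝ) (K : H →L[ℂ] H) :
    schattenSum p K = ∑' x : SingularIndex K, ENNReal.ofReal ((x.1 : ℝ) ^ p) := by
  rw [ENNReal.tsum_sigma']
  exact tsum_congr fun s => by simp [tsum_fintype, singularSpace]

lemma isSymmetric_adjoint_mul_self (K : H →L[ℂ] H) :
    ((ContinuousLinearMap.adjoint K * K : H →L[ℂ] H) : H →ₗ[ℂ] H).IsSymmetric :=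
  ContinuousLinearMap.isSelfAdjoint_iff_isSymmetric.1 (IsSelfAdjoint.star_mul_self K)

lemma finiteDimensional_singularSpace {K : H →L[ℂ] H} (hK : IsCompactOperator K) {s : ℝ}
    (hs : 0 < s) : FiniteDimensional ℂ (singularSpace K s) :=
  ContinuousLinearMap.finite_dimensional_eigenspace
    (hK.clm_comp (ContinuousLinearMap.adjoint K)) _ (by exact_mod_cast (pow_pos hs 2).ne')

/-- A compact operator has an orthonormal family of right singular vectors that spans all the
eigenspaces of `K* K` for nonzero eigenvalues. -/
lemma exists_orthonormal_singular_vectors {K : H →L[ℂ] H} (hK : IsCompactOperator K) :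
    ∃ b : SingularIndex K → H, Orthonormal ℂ b ∧ (∀ x, b x ∈ singularSpace K x.1) ∧
      ∀ s : Set.Ioi (0 : ℝ),
        singularSpace K s ≤ Submodule.span ℂ (Set.range fun i => b ⟨s, i⟩) := by
  have hfd : ∀ s : Set.Ioi (0 : ℝ), FiniteDimensional ℂ (singularSpace K s) :=
    fun s => finiteDimensional_singularSpace hK s.2
  let v : ∀ s : Set.Ioi (0 : ℝ),
      OrthonormalBasis (Fin (Module.finrank ℂ (singularSpace K s))) ℂ (singularSpace K s) :=
    fun s => stdOrthonormalBasis ℂ (singularSpace K s)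
  have horth : OrthogonalFamily ℂ (fun s : Set.Ioi (0 : ℝ) => singularSpace K s)
      (fun s => (singularSpace K s).subtypeₗᵢ) := by
    refine (isSymmetric_adjoint_mul_self K).orthogonalFamily_eigenspaces.comp
      (γ := Set.Ioi (0 : ℝ)) (f := fun s => (((s : ℝ) ^ 2 : ℝ) : ℂ)) fun s t hst => ?_
    have h : (s : ℝ) ^ 2 = (t : ℝ) ^ 2 := Complex.ofReal_injective hst
    exact Subtype.ext ((pow_left_inj₀ (le_of_lt s.2) (le_of_lt t.2) two_ne_zero).1 h)
  refine ⟨fun x => (v x.1 x.2 : H), ?_, fun x => (v x.1 x.2).2, fun s y hy => ?_⟩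
  · exact horth.orthonormal_sigma_orthonormal (v_family := fun s => v s)
      fun s => (v s).orthonormal
  · have h := (v s).sum_repr ⟨y, hy⟩
    have h' : ∑ i, (v s).repr ⟨y, hy⟩ i • (v s i : H) = y := by
      simpa using congrArg (Subtype.val) h
    rw [← h']
    exact Submodule.sum_mem _ fun i _ => Submodule.smul_mem _ _ (Submodule.subset_span ⟨i, rfl⟩)

lemma mem_singularSpace {K : H →L[ℂ] H} {s : ℝ} {x : H} :
    x ∈ singularSpace K s ↔
      (ContinuousLinearMap.adjoint K * K) x = ((s ^ 2 : ℝ) : ℂ) • x := by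
  rw [Module.End.mem_eigenspace_iff]; rfl

lemma norm_apply_sq_eq (K : H →L[ℂ] H) (x : H) :
    ‖K x‖ ^ 2 = (inner ℂ ((ContinuousLinearMap.adjoint K * K) x) x).re := by
  rw [mul_apply_eq_comp, ContinuousLinearMap.adjoint_inner_left]
  exact (inner_self_eq_norm_sq (𝕜 := ℂ) (K x)).symm

/-- On a closed subspace that is orthogonal to the eigenvectors of `K* K` for eigenvalues
exceeding `t ^ 2` and invariant under `K* K`, the operator `K` is bounded by `t`. -/
lemma norm_apply_le_of_mem_orthogonal {K : H →L[ℂ] H} (hK : IsCompactOperator K) {t : ℝ}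
    (ht : 0 < t) {V : Submodule ℂ H}
    (hV : ∀ x ∈ V, (ContinuousLinearMap.adjoint K * K) x ∈ V)
    (hVt : ∀ s : ℝ, t < s → singularSpace K s ≤ V) {x : H} (hx : x ∈ Vᗮ) : ‖K x‖ ≤ t * ‖x‖ := by
  set B : H →L[ℂ] H := ContinuousLinearMap.adjoint K * K with hB
  have hsymm : (B : H →ₗ[ℂ] H).IsSymmetric := isSymmetric_adjoint_mul_self K
  have hinv : ∀ x ∈ Vᗮ, B x ∈ Vᗮ := by
    intro x hx y hy
    have := hsymm y x
    simp only [ContinuousLinearMap.coe_coe] at this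
    rw [← this]
    exact hx _ (hV y hy)
  have hBc : IsCompactOperator B := hK.clm_comp (ContinuousLinearMap.adjoint K)
  let S : Vᗮ →L[ℂ] Vᗮ := B.restrict hinv
  have hSc : IsCompactOperator S := hBc.restrict' hinv
  have hSs : S.IsSymmetric := hsymm.restrict_invariant hinv
  have hnorm : ‖S‖ ≤ t ^ 2 := by
    -- the norm of the self-adjoint `S` is its spectral radius, and by compactness the nonzero
    -- points of its spectrum are eigenvalues
    have h1 := S.spectralRadius_eq_nnnorm hSs.isSelfAdjoint
    have h2 : spectralRadius ℂ S ≤ (Real.toNNReal (t ^ 2) : ℝ≥0∞) := by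
      refine iSup₂_le fun μ hμ => ?_
      rw [ENNReal.coe_le_coe, ← NNReal.coe_le_coe]
      rw [coe_nnnorm, Real.coe_toNNReal _ (sq_nonneg t)]
      by_cases hμ0 : μ = 0
      · rw [hμ0, norm_zero]; positivity
      rw [← hSc.hasEigenvalue_iff_mem_spectrum hμ0] at hμ
      obtain ⟨y, hy⟩ := hμ.exists_hasEigenvector
      have hyB : B (y : H) = μ • (y : H) := by
        have := hy.apply_eq_smul
        exact congrArg Subtype.val this
      have hy0 : (y : H) ≠ 0 := fun h => hy.2 (Subtype.ext h)
      have hyn : (0 : ℝ) < ‖(y : H)‖ ^ 2 := by positivity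
      have hconj : star μ = μ := hSs.conj_eigenvalue_eq_self hμ
      obtain ⟨r, rfl⟩ := Complex.conj_eq_iff_real.1 hconj
      have hKy := norm_apply_sq_eq K (y : H)
      rw [← hB, hyB, inner_smul_left, inner_self_eq_norm_sq_to_K] at hKy
      have hKy' : ‖K y‖ ^ 2 = r * ‖(y : H)‖ ^ 2 := by
        rw [hKy, Complex.conj_ofReal, ← Complex.ofReal_re (r * ‖(y : H)‖ ^ 2)]
        push_cast
        rfl
      have hr : 0 ≤ r := by
        by_contra hr
        nlinarith [sq_nonneg ‖K y‖]
      by_contra hcon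
      rw [Complex.norm_real, Real.norm_of_nonneg hr, not_le] at hcon
      have hts : t < Real.sqrt r := Real.lt_sqrt_of_sq_lt hcon
      have hyV : (y : H) ∈ V := hVt _ hts (mem_singularSpace.2 (by rw [Real.sq_sqrt hr]; exact hyB))
      exact hy0 (inner_self_eq_zero.1 (y.2 _ hyV))
    rw [h1, ENNReal.coe_le_coe, ← NNReal.coe_le_coe, Real.coe_toNNReal _ (sq_nonneg t)] at h2
    exact h2
  have h1 : ‖K x‖ ^ 2 ≤ (t * ‖x‖) ^ 2 := by
    rw [norm_apply_sq_eq]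
    calc (inner ℂ (B x) x).re ≤ ‖inner ℂ (B x) x‖ := Complex.re_le_norm _
      _ ≤ ‖B x‖ * ‖x‖ := norm_inner_le_norm _ _
      _ ≤ (t ^ 2 * ‖x‖) * ‖x‖ := by
        gcongr
        exact S.le_of_opNorm_le hnorm ⟨x, hx⟩
      _ = _ := by ring
  exact le_of_sq_le_sq h1 (by positivity)

lemma approxNumber_le_of_encard_eq {K : H →L[ℂ] H} (hK : IsCompactOperator K) {t : ℝ}
    (ht : 0 < t) {N : ℕ} (hN : {x : SingularIndex K | t < x.1}.encard = N) :
    approxNumber K N ≤ t := by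
  obtain ⟨b, -, hbmem, hbspan⟩ := exists_orthonormal_singular_vectors hK
  set X := {x : SingularIndex K | t < x.1}
  have hX : X.Finite := Set.finite_of_encard_eq_coe hN
  have : Finite (b '' X) := (hX.image b).to_subtype
  let V : Submodule ℂ H := Submodule.span ℂ (b '' X)
  have hfin : FiniteDimensional ℂ V := FiniteDimensional.span_of_finite ℂ (hX.image b)
  have hV : ∀ x ∈ V, (ContinuousLinearMap.adjoint K * K) x ∈ V := by
    intro x hx
    have : V ≤ V.comap ((ContinuousLinearMap.adjoint K * K : H →L[ℂ] H) : H →ₗ[ℂ] H) := by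
      refine Submodule.span_le.2 ?_
      rintro _ ⟨y, hy, rfl⟩
      change (ContinuousLinearMap.adjoint K * K) (b y) ∈ V
      rw [mem_singularSpace.1 (hbmem y)]
      exact V.smul_mem _ (Submodule.subset_span ⟨y, hy, rfl⟩)
    exact this hx
  have hVt : ∀ s : ℝ, t < s → singularSpace K s ≤ V := by
    intro s hs
    refine (hbspan ⟨s, ht.trans hs⟩).trans (Submodule.span_mono ?_)
    rintro _ ⟨i, rfl⟩
    exact ⟨⟨⟨s, ht.trans hs⟩, i⟩, hs, rfl⟩
  have hrank : ((K * V.starProjection : H →L[ℂ] H) : H →ₗ[ℂ] H).rank ≤ (N : Cardinal) := by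
    refine (LinearMap.rank_comp_le_right (V.starProjection : H →ₗ[ℂ] H) (K : H →ₗ[ℂ] H)).trans ?_
    have h1 : LinearMap.range (V.starProjection : H →ₗ[ℂ] H) ≤ V := by
      rintro _ ⟨x, rfl⟩
      exact V.starProjection_apply_mem x
    refine (Submodule.rank_mono h1).trans ((rank_span_le _).trans ?_)
    rw [← Set.cast_ncard (hX.image b)]
    have h2 : X.ncard = N := by rw [Set.ncard, hN]; rfl
    exact_mod_cast (Set.ncard_image_le hX).trans h2.le
  refine (approxNumber_le_norm_sub K hrank).trans ?_
  refine ContinuousLinearMap.opNorm_le_bound _ ht.le fun x => ?_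
  have h2 : (K - K * V.starProjection) x = K (x - V.starProjection x) := by simp
  rw [h2]
  refine (norm_apply_le_of_mem_orthogonal hK ht hV hVt
    (V.sub_starProjection_mem_orthogonal x)).trans ?_
  gcongr
  rw [← V.starProjection_orthogonal_val]
  exact Vᗮ.norm_starProjection_apply_le x

lemma encard_approxNumber_le {K : H →L[ℂ] H} (hK : IsCompactOperator K) {t : ℝ} (ht : 0 < t) :
    {k : ℕ | t < approxNumber K k}.encard ≤ {x : SingularIndex K | t < x.1}.encard := by
  by_cases htop : {x : SingularIndex K | t < x.1}.encard = ⊤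
  · rw [htop]; exact le_top
  obtain ⟨N, hN⟩ := ENat.ne_top_iff_exists.1 htop
  have h := approxNumber_le_of_encard_eq hK ht hN.symm
  have hsub : {k : ℕ | t < approxNumber K k} ⊆ (Finset.range N : Set ℕ) := by
    intro k hk
    rw [Finset.coe_range, Set.mem_Iio]
    by_contra hcon
    exact absurd ((approxNumber_antitone K (not_lt.1 hcon)).trans h) (not_le.2 hk)
  refine (Set.encard_le_encard hsub).trans ?_
  rw [Set.encard_coe_eq_coe_finsetCard, Finset.card_range, hN]

/-- A subspace spanned by `n` singular vectors meets the kernel of every operator of rank less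
than `n`, so `n` singular values exceeding `t` force `n` approximation numbers to exceed `t`. -/
lemma lt_approxNumber_of_lt_card {K : H →L[ℂ] H} (hK : IsCompactOperator K) {t : ℝ}
    (X : Finset (SingularIndex K)) (hX : ∀ x ∈ X, t < x.1) {k : ℕ} (hk : k < X.card) :
    t < approxNumber K k := by
  obtain ⟨b, hb, hbmem, -⟩ := exists_orthonormal_singular_vectors hK
  have hne : X.Nonempty := Finset.card_pos.1 (by omega)
  obtain ⟨x₀, hx₀, hmin⟩ := X.exists_min_image (fun x => (x.1 : ℝ)) hne
  refine (hX x₀ hx₀).trans_le (le_approxNumber fun F hF => ?_)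
  let L : (X → ℂ) →ₗ[ℂ] H := Fintype.linearCombination ℂ fun x : X => b x
  have hninj : ¬ Function.Injective ((F : H →ₗ[ℂ] H) ∘ₗ L) := by
    intro hinj
    have h1 := LinearMap.finrank_range_of_inj hinj
    have h2 : ((F : H →ₗ[ℂ] H) ∘ₗ L).rank ≤ k := (LinearMap.rank_comp_le_left _ _).trans hF
    have h3 := Module.finrank_le_of_rank_le h2
    rw [h1] at h3
    simp at h3
    omega
  obtain ⟨c, hc, hc0⟩ : ∃ c : X → ℂ, F (L c) = 0 ∧ c ≠ 0 := by
    by_contra hcon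
    push Not at hcon
    exact hninj ((injective_iff_map_eq_zero _).2 fun c hc => hcon c hc)
  have hLc : L c = ∑ x : X, c x • b x := rfl
  have hbX : Orthonormal ℂ (fun x : X => b x) := hb.comp _ Subtype.val_injective
  have hnorm : ‖L c‖ ^ 2 = ∑ x : X, ‖c x‖ ^ 2 := by
    rw [hLc, ← inner_self_eq_norm_sq (𝕜 := ℂ), hbX.inner_sum]
    simp only [map_sum, RCLike.re_to_complex]
    refine Finset.sum_congr rfl fun x _ => ?_
    rw [Complex.conj_mul']
    norm_cast
  have hpos : 0 < ‖L c‖ := by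
    refine norm_pos_iff.2 fun h => hc0 ?_
    have := Fintype.linearIndependent_iff.1 hbX.linearIndependent c (by rw [← hLc, h])
    exact funext this
  have hKn : (x₀.1 : ℝ) ^ 2 * ‖L c‖ ^ 2 ≤ ‖K (L c)‖ ^ 2 := by
    rw [norm_apply_sq_eq, hnorm, hLc, map_sum]
    have : ∀ x : X, (ContinuousLinearMap.adjoint K * K) (c x • b x) =
        (c x * (((x.1.1 : ℝ) ^ 2 : ℝ) : ℂ)) • b x := by
      intro x
      rw [map_smul, mem_singularSpace.1 (hbmem x), smul_smul]
    simp_rw [this]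
    rw [hbX.inner_sum, Complex.re_sum, Finset.mul_sum]
    refine Finset.sum_le_sum fun x _ => ?_
    have h1 : (x₀.1 : ℝ) ^ 2 ≤ (x.1.1 : ℝ) ^ 2 := by
      have := hmin x.1 x.2
      have := x₀.1.2.out
      gcongr
    have h2 : (starRingEnd ℂ) (c x * (((x.1.1 : ℝ) ^ 2 : ℝ) : ℂ)) * c x =
        (((x.1.1 : ℝ) ^ 2 * ‖c x‖ ^ 2 : ℝ) : ℂ) := by
      rw [map_mul, Complex.conj_ofReal, mul_right_comm, Complex.conj_mul']
      push_cast
      ring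
    rw [h2, Complex.ofReal_re]
    gcongr
  have h1 : (x₀.1 : ℝ) * ‖L c‖ ≤ ‖K (L c)‖ := by
    refine le_of_sq_le_sq ?_ (norm_nonneg _)
    rwa [mul_pow]
  have h2 : (K - F) (L c) = K (L c) := by simp [hc]
  have h3 := (K - F).le_opNorm (L c)
  rw [h2] at h3
  exact le_of_mul_le_mul_right (h1.trans h3) hpos

lemma encard_le_encard_approxNumber {K : H →L[ℂ] H} (hK : IsCompactOperator K) {t : ℝ} :
    {x : SingularIndex K | t < x.1}.encard ≤ {k : ℕ | t < approxNumber K k}.encard := by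
  have key : ∀ X : Finset (SingularIndex K), (X : Set _) ⊆ {x : SingularIndex K | t < x.1} →
      (X.card : ℕ∞) ≤ {k : ℕ | t < approxNumber K k}.encard := by
    intro X hX
    rw [← Finset.card_range X.card, ← Set.encard_coe_eq_coe_finsetCard]
    refine Set.encard_le_encard fun k hk => ?_
    exact lt_approxNumber_of_lt_card hK X (fun x hx => hX hx) (Finset.mem_range.1 hk)
  by_cases hfin : {x : SingularIndex K | t < x.1}.Finite
  · rw [hfin.encard_eq_coe_toFinset_card]
    exact key _ (by simp)
  · have : {k : ℕ | t < approxNumber K k}.encard = ⊤ := by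
      refine ENat.eq_top_iff_forall_ge.2 fun m => ?_
      obtain ⟨X, hX, hc⟩ := Set.Infinite.exists_subset_card_eq hfin m
      rw [← hc]
      exact key X hX
    rw [this]; exact le_top

/-- The nonzero singular values of a compact operator are its nonzero approximation numbers. -/
theorem schattenSum_eq_tsum_approxNumber {K : H →L[ℂ] H} (hK : IsCompactOperator K) {p : ℝ}
    (hp : 0 < p) : schattenSum p K = ∑' k, ENNReal.ofReal (approxNumber K k ^ p) := by
  rw [schattenSum_eq_tsum]
  exact le_antisymm
    (tsum_rpow_le_of_encard_le (fun x => le_of_lt x.1.2) (approxNumber_nonneg K) hp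
      fun t _ => encard_le_encard_approxNumber hK)
    (tsum_rpow_le_of_encard_le (approxNumber_nonneg K) (fun x => le_of_lt x.1.2) hp
      fun t ht => encard_approxNumber_le hK ht)

end

section

/-! ### Integrals along rays and Hankel contours -/

section Contour

open MeasureTheory ComplexConjugate

variable {E : Type*} [NormedAddCommGroup E] [NormedSpace ℂ E]

/-- The ray `{1 + r e : r ≥ 0}` from `1` in the direction `e`. -/
def ray (e : ℂ) : Set ℂ := (fun r : ℝ => 1 + r * e) '' Set.Ici 0

lemma one_add_mul_mem_ray (e : ℂ) {r : ℝ} (hr : 0 ≤ r) : 1 + r * e ∈ ray e := ⟨r, hr, rfl⟩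

/-- The integral `∫ f(u) du` along the ray from `1` in the direction `e`. -/
def rayIntegral (e : ℂ) (f : ℂ → E) : E := ∫ r in Set.Ioi (0 : ℝ), e • f (1 + r * e)

/-- `f` is continuous on the set `s` and bounded there by `C |exp u|`. -/
structure ExpBoundedOn (C : ℝ) (f : ℂ → E) (s : Set ℂ) : Prop where
  continuousOn : ContinuousOn f s
  norm_le : ∀ u ∈ s, ‖f u‖ ≤ C * Real.exp u.re

omit [NormedSpace ℂ E] in
lemma ExpBoundedOn.mono {C : ℝ} {f : ℂ → E} {s t : Set ℂ} (h : ExpBoundedOn C f t) (hst : s ⊆ t) :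
    ExpBoundedOn C f s :=
  ⟨h.continuousOn.mono hst, fun u hu => h.norm_le u (hst hu)⟩

omit [NormedSpace ℂ E] in
lemma ExpBoundedOn.sub {C C' : ℝ} {f g : ℂ → E} {s : Set ℂ} (hf : ExpBoundedOn C f s)
    (hg : ExpBoundedOn C' g s) : ExpBoundedOn (C + C') (fun u => f u - g u) s :=
  ⟨hf.continuousOn.sub hg.continuousOn, fun u hu => (norm_sub_le _ _).trans
    ((add_le_add (hf.norm_le u hu) (hg.norm_le u hu)).trans_eq (add_mul _ _ _).symm)⟩

lemma ExpBoundedOn.clm_comp {E' : Type*} [NormedAddCommGroup E'] [NormedSpace ℂ E'] {C : ℝ}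
    {f : ℂ → E} {s : Set ℂ} (hf : ExpBoundedOn C f s) (L : E →L[ℂ] E') :
    ExpBoundedOn (‖L‖ * C) (fun u => L (f u)) s :=
  ⟨L.continuous.comp_continuousOn hf.continuousOn, fun u hu => (L.le_opNorm _).trans
    ((mul_le_mul_of_nonneg_left (hf.norm_le u hu) (norm_nonneg _)).trans_eq
      (mul_assoc _ _ _).symm)⟩

lemma continuousOn_comp_ray {f : ℂ → E} {e : ℂ} (hf : ContinuousOn f (ray e)) :
    ContinuousOn (fun r : ℝ => e • f (1 + r * e)) (Set.Ici 0) :=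
  (hf.comp (by fun_prop) fun r hr => one_add_mul_mem_ray e hr).const_smul e

lemma exp_re_one_add (e : ℂ) (r : ℝ) :
    Real.exp (1 + r * e : ℂ).re = Real.exp 1 * Real.exp (e.re * r) := by
  rw [← Real.exp_add]; simp [mul_comm]

lemma integrable_ray_bound {e : ℂ} (he : e.re < 0) (C : ℝ) :
    IntegrableOn (fun r : ℝ => ‖e‖ * (C * Real.exp (1 + r * e : ℂ).re)) (Set.Ioi 0) := by
  simp_rw [exp_re_one_add]
  exact (((integrableOn_exp_mul_Ioi he 0).const_mul _).const_mul _).const_mul _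

lemma ExpBoundedOn.norm_ray_le {C : ℝ} {f : ℂ → E} {e : ℂ} (hf : ExpBoundedOn C f (ray e)) :
    ∀ᵐ r : ℝ ∂volume.restrict (Set.Ioi (0 : ℝ)),
      ‖e • f (1 + r * e)‖ ≤ ‖e‖ * (C * Real.exp (1 + r * e : ℂ).re) := by
  refine (ae_restrict_mem measurableSet_Ioi).mono fun r hr => ?_
  rw [norm_smul]
  exact mul_le_mul_of_nonneg_left (hf.norm_le _ (one_add_mul_mem_ray e (le_of_lt hr)))
    (norm_nonneg _)

lemma ExpBoundedOn.integrableOn_ray {C : ℝ} {f : ℂ → E} {e : ℂ} (he : e.re < 0)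
    (hf : ExpBoundedOn C f (ray e)) :
    IntegrableOn (fun r : ℝ => e • f (1 + r * e)) (Set.Ioi 0) :=
  Integrable.mono' (integrable_ray_bound he C)
    (((continuousOn_comp_ray hf.continuousOn).mono Set.Ioi_subset_Ici_self).aestronglyMeasurable
      measurableSet_Ioi) hf.norm_ray_le

lemma ExpBoundedOn.norm_rayIntegral_le {C : ℝ} {f : ℂ → E} {e : ℂ} (he : e.re < 0)
    (hf : ExpBoundedOn C f (ray e)) :
    ‖rayIntegral e f‖ ≤ C * (‖e‖ * Real.exp 1 / (-e.re)) := by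
  refine (norm_integral_le_of_norm_le (integrable_ray_bound he C) hf.norm_ray_le).trans_eq ?_
  simp_rw [exp_re_one_add]
  rw [integral_const_mul, integral_const_mul, integral_const_mul, integral_exp_mul_Ioi he]
  have := he.ne
  simp
  field_simp

lemma tendsto_exp_re_ray {e : ℂ} (he : e.re < 0) :
    Tendsto (fun r : ℝ => Real.exp (1 + r * e : ℂ).re) atTop (𝓝 0) := by
  simp_rw [exp_re_one_add]
  have h : Tendsto (fun r : ℝ => e.re * r) atTop atBot := tendsto_id.const_mul_atTop_of_neg he
  simpa using (Real.tendsto_exp_atBot.comp h).const_mul (Real.exp 1)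

lemma hasDerivAt_comp_ray {f : ℂ → E} {f' : E} {e : ℂ} {r : ℝ}
    (hf : HasDerivAt f f' (1 + r * e)) : HasDerivAt (fun r : ℝ => f (1 + r * e)) (e • f') r := by
  have h1 : HasDerivAt (fun r : ℝ => (1 : ℂ) + r * e) e r := by
    simpa using ((Complex.ofRealCLM.hasDerivAt (x := r)).mul_const e).const_add 1
  exact hf.scomp r h1

lemma rayIntegral_deriv [CompleteSpace E] {C C' : ℝ} {f f' : ℂ → E} {e : ℂ} (he : e.re < 0)
    (hf : ∀ u ∈ ray e, HasDerivAt f (f' u) u) (hf' : ExpBoundedOn C f' (ray e))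
    (hfb : ∀ u ∈ ray e, ‖f u‖ ≤ C' * Real.exp u.re) : rayIntegral e f' = -f 1 := by
  have h := integral_Ioi_of_hasDerivAt_of_tendsto' (a := 0) (m := 0)
    (f := fun r : ℝ => f (1 + r * e)) (f' := fun r : ℝ => e • f' (1 + r * e))
    (fun r hr => hasDerivAt_comp_ray (hf _ (one_add_mul_mem_ray e hr)))
    (hf'.integrableOn_ray he) ?_
  · rw [rayIntegral, h]; simp
  · refine squeeze_zero_norm' ?_
      (by simpa only [mul_zero] using (tendsto_exp_re_ray he).const_mul C')
    filter_upwards [eventually_ge_atTop 0] with r hr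
    exact hfb _ (one_add_mul_mem_ray e hr)

/-- Differentiation under the ray integral. -/
lemma hasDerivAt_rayIntegral {e : ℂ} (he : e.re < 0) {C C' : ℝ} {f f' : ℂ → ℂ → E} {z₀ : ℂ}
    {s : Set ℂ} (hs : s ∈ 𝓝 z₀) (hf : ∀ z ∈ s, ExpBoundedOn C (f z) (ray e))
    (hf' : ∀ z ∈ s, ExpBoundedOn C' (f' z) (ray e))
    (hd : ∀ z ∈ s, ∀ u ∈ ray e, HasDerivAt (fun z => f z u) (f' z u) z) :
    HasDerivAt (fun z => rayIntegral e (f z)) (rayIntegral e (f' z₀)) z₀ := by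
  have hz₀ := mem_of_mem_nhds hs
  refine (hasDerivAt_integral_of_dominated_loc_of_deriv_le (μ := volume.restrict (Set.Ioi (0 : ℝ)))
    (F := fun z (r : ℝ) => e • f z (1 + r * e)) (F' := fun z (r : ℝ) => e • f' z (1 + r * e))
    (bound := fun r : ℝ => ‖e‖ * (C' * Real.exp (1 + r * e : ℂ).re)) hs ?_
    ((hf z₀ hz₀).integrableOn_ray he) ((hf' z₀ hz₀).integrableOn_ray he).aestronglyMeasurable ?_
    (integrable_ray_bound he C') ?_).2
  · filter_upwards [hs] with z hz
    exact ((hf z hz).integrableOn_ray he).aestronglyMeasurable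
  · refine (ae_restrict_mem measurableSet_Ioi).mono fun r hr z hz => ?_
    rw [norm_smul]
    exact mul_le_mul_of_nonneg_left ((hf' z hz).norm_le _ (one_add_mul_mem_ray e (le_of_lt hr)))
      (norm_nonneg _)
  · refine (ae_restrict_mem measurableSet_Ioi).mono fun r hr z hz => ?_
    exact (hd z hz _ (one_add_mul_mem_ray e (le_of_lt hr))).const_smul e

/-- The directions `e` such that the two rays from `1` in the directions `conj e` and `e` form a
Hankel contour, running around the negative real axis. -/
structure IsHankelDirection (e : ℂ) : Prop where
  norm_eq : ‖e‖ = 1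
  re_neg : e.re < 0
  im_pos : 0 < e.im

/-- The Hankel contour with directions `conj e` and `e`, as a set. -/
def hankelContour (e : ℂ) : Set ℂ := ray e ∪ ray (conj e)

/-- The integral `(2πi)⁻¹ ∫ f(u) du` along the Hankel contour with directions `conj e` and `e`. -/
def hankelIntegral (e : ℂ) (f : ℂ → E) : E :=
  (2 * Real.pi * Complex.I : ℂ)⁻¹ • (rayIntegral e f - rayIntegral (conj e) f)

lemma hankelIntegral_congr {e : ℂ} {f g : ℂ → E} (h : Set.EqOn f g (hankelContour e)) :
    hankelIntegral e f = hankelIntegral e g := by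
  have h' : ∀ e', ray e' ⊆ hankelContour e → rayIntegral e' f = rayIntegral e' g :=
    fun e' hsub => setIntegral_congr_fun measurableSet_Ioi fun r hr => by
      simp only [h (hsub (one_add_mul_mem_ray e' (le_of_lt hr)))]
  rw [hankelIntegral, hankelIntegral, h' e Set.subset_union_left,
    h' (conj e) Set.subset_union_right]

/-- The constant bounding the Hankel integral of functions which are at most `|exp u|`. -/
def hankelConst (e : ℂ) : ℝ := Real.exp 1 / (-e.re)

namespace IsHankelDirection

variable {e : ℂ} (he : IsHankelDirection e)
include he

lemma re_conj_neg : (conj e).re < 0 := by simpa using he.re_neg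

lemma hankelConst_nonneg : 0 ≤ hankelConst e :=
  div_nonneg (Real.exp_pos 1).le (neg_nonneg.2 he.re_neg.le)

lemma norm_hankelIntegral_le {C : ℝ} {f : ℂ → E} (hf : ExpBoundedOn C f (hankelContour e)) :
    ‖hankelIntegral e f‖ ≤ C * hankelConst e := by
  have h1 := (hf.mono Set.subset_union_left).norm_rayIntegral_le he.re_neg
  have h2 := (hf.mono Set.subset_union_right).norm_rayIntegral_le he.re_conj_neg
  rw [RCLike.norm_conj, Complex.conj_re, he.norm_eq, one_mul] at h2
  rw [he.norm_eq, one_mul] at h1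
  have h3 : ‖rayIntegral e f - rayIntegral (conj e) f‖ ≤ 2 * (C * hankelConst e) :=
    (norm_sub_le _ _).trans (by rw [two_mul]; exact add_le_add h1 h2)
  have h0 : 0 ≤ C * hankelConst e := (norm_nonneg _).trans h1
  rw [hankelIntegral, norm_smul, norm_inv, norm_mul, norm_mul, Complex.norm_I, mul_one,
    Complex.norm_ofNat, Complex.norm_real, Real.norm_of_nonneg Real.pi_pos.le]
  calc _ ≤ (2 * Real.pi)⁻¹ * (2 * (C * hankelConst e)) := by gcongr
    _ = Real.pi⁻¹ * (C * hankelConst e) := by field_simp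
    _ ≤ 1 * (C * hankelConst e) := by
      gcongr
      exact inv_le_one_of_one_le₀ (by linarith [Real.pi_gt_three])
    _ = _ := one_mul _

lemma hankelIntegral_sub {C C' : ℝ} {f g : ℂ → E} (hf : ExpBoundedOn C f (hankelContour e))
    (hg : ExpBoundedOn C' g (hankelContour e)) :
    hankelIntegral e (fun u => f u - g u) = hankelIntegral e f - hankelIntegral e g := by
  simp only [hankelIntegral, rayIntegral, smul_sub e, smul_sub (conj e)]
  rw [integral_sub ((hf.mono Set.subset_union_left).integrableOn_ray he.re_neg)
      ((hg.mono Set.subset_union_left).integrableOn_ray he.re_neg),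
    integral_sub ((hf.mono Set.subset_union_right).integrableOn_ray he.re_conj_neg)
      ((hg.mono Set.subset_union_right).integrableOn_ray he.re_conj_neg), ← smul_sub]
  congr 1
  abel

lemma hankelIntegral_clm_comp [CompleteSpace E] {E' : Type*} [NormedAddCommGroup E']
    [NormedSpace ℂ E'] [CompleteSpace E'] (L : E →L[ℂ] E') {C : ℝ} {f : ℂ → E}
    (hf : ExpBoundedOn C f (hankelContour e)) :
    hankelIntegral e (fun u => L (f u)) = L (hankelIntegral e f) := by
  simp only [hankelIntegral, rayIntegral, map_smul, map_sub]
  rw [← L.integral_comp_comm ((hf.mono Set.subset_union_left).integrableOn_ray he.re_neg),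
    ← L.integral_comp_comm ((hf.mono Set.subset_union_right).integrableOn_ray he.re_conj_neg)]
  simp only [map_smul]

lemma hankelIntegral_deriv_eq_zero [CompleteSpace E] {C C' : ℝ} {f f' : ℂ → E}
    (hf : ∀ u ∈ hankelContour e, HasDerivAt f (f' u) u)
    (hf' : ExpBoundedOn C f' (hankelContour e))
    (hfb : ∀ u ∈ hankelContour e, ‖f u‖ ≤ C' * Real.exp u.re) : hankelIntegral e f' = 0 := by
  rw [hankelIntegral,
    rayIntegral_deriv he.re_neg (fun u hu => hf u (.inl hu)) (hf'.mono Set.subset_union_left)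
      (fun u hu => hfb u (.inl hu)),
    rayIntegral_deriv he.re_conj_neg (fun u hu => hf u (.inr hu)) (hf'.mono Set.subset_union_right)
      (fun u hu => hfb u (.inr hu)), sub_self, smul_zero]

lemma hasDerivAt_hankelIntegral {C C' : ℝ} {f f' : ℂ → ℂ → E} {z₀ : ℂ}
    {s : Set ℂ} (hs : s ∈ 𝓝 z₀) (hf : ∀ z ∈ s, ExpBoundedOn C (f z) (hankelContour e))
    (hf' : ∀ z ∈ s, ExpBoundedOn C' (f' z) (hankelContour e))
    (hd : ∀ z ∈ s, ∀ u ∈ hankelContour e, HasDerivAt (fun z => f z u) (f' z u) z) :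
    HasDerivAt (fun z => hankelIntegral e (f z)) (hankelIntegral e (f' z₀)) z₀ :=
  ((hasDerivAt_rayIntegral he.re_neg hs (fun z hz => (hf z hz).mono Set.subset_union_left)
      (fun z hz => (hf' z hz).mono Set.subset_union_left) fun z hz u hu => hd z hz u (.inl hu)).sub
    (hasDerivAt_rayIntegral he.re_conj_neg hs (fun z hz => (hf z hz).mono Set.subset_union_right)
      (fun z hz => (hf' z hz).mono Set.subset_union_right)
      fun z hz u hu => hd z hz u (.inr hu))).const_smul _

lemma im_le_norm_of_mem_ray {u : ℂ} (hu : u ∈ ray e) : e.im ≤ ‖u‖ := by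
  obtain ⟨r, hr, rfl⟩ := hu
  have h : ((1 + r * e) * conj e).im = -e.im := by
    simp; ring
  calc e.im = |((1 + r * e) * conj e).im| := by rw [h, abs_neg, abs_of_pos he.im_pos]
    _ ≤ ‖(1 + r * e) * conj e‖ := Complex.abs_im_le_norm _
    _ = _ := by rw [norm_mul, RCLike.norm_conj, he.norm_eq, mul_one]

omit he in
lemma conj_mem_ray {u : ℂ} (hu : u ∈ ray (conj e)) : conj u ∈ ray e := by
  obtain ⟨r, hr, rfl⟩ := hu
  exact ⟨r, hr, by simp⟩

lemma im_le_norm {u : ℂ} (hu : u ∈ hankelContour e) : e.im ≤ ‖u‖ := by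
  rcases hu with hu | hu
  · exact he.im_le_norm_of_mem_ray hu
  · simpa using he.im_le_norm_of_mem_ray (conj_mem_ray hu)

lemma ne_zero {u : ℂ} (hu : u ∈ hankelContour e) : u ≠ 0 :=
  norm_pos_iff.1 (he.im_pos.trans_le (he.im_le_norm hu))

lemma arg_pos : 0 < e.arg := by
  refine lt_of_le_of_ne (Complex.arg_nonneg_iff.2 he.im_pos.le) fun h => ?_
  have := (Complex.arg_eq_zero_iff.1 h.symm).1
  linarith [he.re_neg]

lemma arg_lt_pi : e.arg < Real.pi :=
  Complex.arg_lt_pi_iff.2 (.inr he.im_pos.ne')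

lemma abs_arg_le_of_mem_ray {u : ℂ} (hu : u ∈ ray e) : |u.arg| ≤ e.arg := by
  have hu0 : 0 < ‖u‖ := he.im_pos.trans_le (he.im_le_norm_of_mem_ray hu)
  obtain ⟨r, hr, rfl⟩ := hu
  set u : ℂ := 1 + r * e with hudef
  have hr : 0 ≤ r := hr
  have him : 0 ≤ u.im := by simp [hudef]; exact mul_nonneg hr he.im_pos.le
  have hu1 : 0 ≤ u.arg := Complex.arg_nonneg_iff.2 him
  rw [abs_of_nonneg hu1]
  by_contra hcon
  push Not at hcon
  have hs : 0 < Real.sin (u.arg - e.arg) ∨ u.arg - e.arg = Real.pi := by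
    have h1 := Complex.arg_le_pi u
    rcases (show u.arg - e.arg ≤ Real.pi by linarith [he.arg_pos]).lt_or_eq with h | h
    · exact .inl (Real.sin_pos_of_pos_of_lt_pi (by linarith) h)
    · exact .inr h
  have h2 : ‖u‖ * Real.sin (u.arg - e.arg) = -e.im := by
    rw [Real.sin_sub]
    have hc : Real.cos e.arg = e.re := by
      have := Complex.norm_mul_cos_arg e
      rwa [he.norm_eq, one_mul] at this
    have hs : Real.sin e.arg = e.im := by
      have := Complex.norm_mul_sin_arg e
      rwa [he.norm_eq, one_mul] at this
    rw [hc, hs, mul_sub, ← mul_assoc, ← mul_assoc, Complex.norm_mul_sin_arg,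
      Complex.norm_mul_cos_arg]
    simp [hudef]; ring
  rcases hs with hs | hs
  · have := mul_pos hu0 hs
    linarith [he.im_pos]
  · linarith [he.arg_pos, Complex.arg_le_pi u]

lemma abs_arg_le {u : ℂ} (hu : u ∈ hankelContour e) : |u.arg| ≤ e.arg := by
  rcases hu with hu | hu
  · exact he.abs_arg_le_of_mem_ray hu
  · have h := he.abs_arg_le_of_mem_ray (conj_mem_ray hu)
    rw [Complex.arg_conj] at h
    split_ifs at h with h'
    · rwa [h']
    · rwa [abs_neg] at h

lemma mem_slitPlane {u : ℂ} (hu : u ∈ hankelContour e) : u ∈ Complex.slitPlane := by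
  rw [Complex.mem_slitPlane_iff_arg]
  refine ⟨fun h => ?_, he.ne_zero hu⟩
  have := he.abs_arg_le hu
  rw [h, abs_of_pos Real.pi_pos] at this
  linarith [he.arg_lt_pi]

lemma expBoundedOn_exp_div :
    ExpBoundedOn e.im⁻¹ (fun u => Complex.exp u / u) (hankelContour e) := by
  refine ⟨Complex.continuous_exp.continuousOn.div continuousOn_id fun u hu => he.ne_zero hu,
    fun u hu => ?_⟩
  rw [norm_div, Complex.norm_exp, div_eq_inv_mul]
  have := he.im_le_norm hu
  have := he.im_pos
  gcongr

end IsHankelDirection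

/-- Let `Φ` be a primitive of the entire function `(exp u - 1) / u`. On the arc `|u| = R` from the
argument `σ φ` to `σ π`, where `σ = ±1`, the derivative of `Φ(u) + i arg u` with respect to `arg u`
is `i exp u`, and `|exp u|` is largest at the argument `σ φ`. -/
lemma norm_primitive_arc_le {Φ : ℂ → ℂ} (hΦ : ∀ u, HasDerivAt Φ (dslope Complex.exp 0 u) u)
    {R φ σ : ℝ} (hR : 0 < R) (hφ : 0 ≤ φ) (hφ' : φ ≤ Real.pi) (hσ : |σ| = 1) :
    ‖(Φ (R * Complex.exp (σ * Real.pi * Complex.I)) + σ * Real.pi * Complex.I) -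
      (Φ (R * Complex.exp (σ * φ * Complex.I)) + σ * φ * Complex.I)‖ ≤
      Real.exp (R * Real.cos φ) * (Real.pi - φ) := by
  have hderiv : ∀ ψ : ℝ, HasDerivAt
      (fun ψ : ℝ => Φ (R * Complex.exp (σ * ψ * Complex.I)) + σ * ψ * Complex.I)
      (σ * Complex.I * Complex.exp (R * Complex.exp (σ * ψ * Complex.I))) ψ := by
    intro ψ
    have h0 : HasDerivAt (fun ψ : ℝ => (σ * ψ * Complex.I : ℂ)) (σ * Complex.I) ψ := by
      simpa using (((Complex.ofRealCLM.hasDerivAt (x := ψ)).const_mul (σ : ℂ)).mul_const Complex.I)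
    have h1 := (h0.cexp).const_mul (R : ℂ)
    have h2 := ((hΦ _).scomp ψ h1).add h0
    refine h2.congr_deriv ?_
    set u : ℂ := R * Complex.exp (σ * ψ * Complex.I) with hu
    have hu0 : u ≠ 0 := mul_ne_zero (by exact_mod_cast hR.ne') (Complex.exp_ne_zero _)
    rw [dslope_of_ne _ hu0, slope_def_field, ← mul_assoc, ← hu]
    simp only [smul_eq_mul, sub_zero, Complex.exp_zero]
    field_simp
    ring
  refine norm_image_sub_le_of_norm_deriv_le_segment' (a := φ) (b := Real.pi)
    (f := fun ψ : ℝ => Φ (R * Complex.exp (σ * ψ * Complex.I)) + σ * ψ * Complex.I)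
    (fun ψ _ => (hderiv ψ).hasDerivWithinAt) (fun ψ hψ => ?_) Real.pi ⟨hφ', le_rfl⟩
  have hre : (R * Complex.exp (σ * ψ * Complex.I)).re = R * Real.cos ψ := by
    rw [Complex.re_ofReal_mul, ← Complex.ofReal_mul, Complex.exp_ofReal_mul_I_re]
    rcases (abs_eq zero_le_one).1 hσ with h | h <;> simp [h]
  rw [norm_mul, norm_mul, Complex.norm_real, Complex.norm_I, Real.norm_eq_abs, hσ, one_mul, one_mul,
    Complex.norm_exp, hre]
  gcongr
  exact Real.cos_le_cos_of_nonneg_of_le_pi hφ hψ.2.le hψ.1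

/-- Hankel's integral for `1 / Γ(1)`. A primitive of `exp u / u` on the slit plane is
`Φ(u) + log u`, where `Φ` is a primitive of `(exp u - 1) / u`. At `u` and `conj u` it differs by
`2πi + O(|exp u|)`, as `Φ` is single-valued on the negative real axis while the two limits
of `log` there differ by `2πi`. -/
lemma IsHankelDirection.hankelIntegral_exp_div {e : ℂ} (he : IsHankelDirection e) :
    hankelIntegral e (fun u => Complex.exp u / u) = 1 := by
  have hdiff : Differentiable ℂ (dslope Complex.exp 0) := by
    rw [← differentiableOn_univ, Complex.differentiableOn_dslope univ_mem]
    exact Complex.differentiable_exp.differentiableOn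
  obtain ⟨Φ, hΦ⟩ := hdiff.isExactOn_univ
  replace hΦ : ∀ u, HasDerivAt Φ (dslope Complex.exp 0 u) u := fun u => hΦ u trivial
  have hprim : ∀ u ∈ hankelContour e,
      HasDerivAt (fun u => Φ u + Complex.log u) (Complex.exp u / u) u := by
    intro u hu
    refine ((hΦ u).add (Complex.hasDerivAt_log (he.mem_slitPlane hu))).congr_deriv ?_
    have hu0 := he.ne_zero hu
    rw [dslope_of_ne _ hu0, slope_def_field]
    simp only [sub_zero, Complex.exp_zero]
    field_simp
    ring
  have hbd := he.expBoundedOn_exp_div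
  have hInt : ∀ e' : ℂ, e'.re < 0 → ray e' ⊆ hankelContour e →
      Tendsto (fun r : ℝ => (Φ (1 + r * e') + Complex.log (1 + r * e')) - (Φ 1 + Complex.log 1))
        atTop (𝓝 (rayIntegral e' fun u => Complex.exp u / u)) := by
    intro e' he' hsub
    have hi := (hbd.mono hsub).integrableOn_ray he'
    refine (intervalIntegral_tendsto_integral_Ioi 0 hi tendsto_id).congr' ?_
    filter_upwards [eventually_ge_atTop 0] with r hr
    rw [id, intervalIntegral.integral_eq_sub_of_hasDerivAt
      (f := fun r : ℝ => Φ (1 + r * e') + Complex.log (1 + r * e'))]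
    · simp
    · intro x hx
      rw [Set.uIcc_of_le hr] at hx
      exact hasDerivAt_comp_ray (hprim _ (hsub (one_add_mul_mem_ray e' hx.1)))
    · rw [intervalIntegrable_iff_integrableOn_Ioc_of_le hr]
      exact hi.mono_set Set.Ioc_subset_Ioi_self
  have h1 := (hInt e he.re_neg Set.subset_union_left).sub
    (hInt (conj e) he.re_conj_neg Set.subset_union_right)
  have h2 : Tendsto (fun r : ℝ =>
      ((Φ (1 + r * e) + Complex.log (1 + r * e)) - (Φ 1 + Complex.log 1)) -
      ((Φ (1 + r * conj e) + Complex.log (1 + r * conj e)) - (Φ 1 + Complex.log 1)))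
      atTop (𝓝 (2 * Real.pi * Complex.I)) := by
    rw [tendsto_iff_norm_sub_tendsto_zero]
    refine squeeze_zero' (Eventually.of_forall fun _ => norm_nonneg _) ?_
      (by simpa only [mul_zero] using (tendsto_exp_re_ray he.re_neg).const_mul (2 * Real.pi))
    filter_upwards [eventually_ge_atTop 0] with r hr
    have hur : (1 + r * e : ℂ) ∈ ray e := one_add_mul_mem_ray e hr
    have huc : (1 + r * conj e : ℂ) = conj (1 + r * e : ℂ) := by simp
    rw [huc]
    have hslit := he.mem_slitPlane (.inl hur)
    set u : ℂ := 1 + r * e with hudef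
    have hu0 : 0 < ‖u‖ := norm_pos_iff.2 (he.ne_zero (.inl hur))
    have him : 0 ≤ u.im := by simp [hudef]; exact mul_nonneg hr he.im_pos.le
    have harg : 0 ≤ u.arg := Complex.arg_nonneg_iff.2 him
    have e1 := norm_primitive_arc_le hΦ hu0 harg (Complex.arg_le_pi u) (σ := 1) (by simp)
    have e2 := norm_primitive_arc_le hΦ hu0 harg (Complex.arg_le_pi u) (σ := -1) (by simp)
    rw [Complex.norm_mul_cos_arg] at e1 e2
    have hu_eq : (‖u‖ * Complex.exp ((1 : ℝ) * u.arg * Complex.I) : ℂ) = u := by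
      simp
    have hcu_eq : (‖u‖ * Complex.exp ((-1 : ℝ) * u.arg * Complex.I) : ℂ) = conj u := by
      conv_rhs => rw [← Complex.norm_mul_exp_arg_mul_I u]
      rw [map_mul, Complex.conj_ofReal, ← Complex.exp_conj]
      simp
    have hpi1 : Complex.exp ((1 : ℝ) * Real.pi * Complex.I) = -1 := by
      simp
    have hpi2 : Complex.exp ((-1 : ℝ) * Real.pi * Complex.I) = -1 := by
      have : ((-1 : ℝ) * Real.pi * Complex.I : ℂ) = -(Real.pi * Complex.I) := by push_cast; ring
      rw [this, Complex.exp_neg, Complex.exp_pi_mul_I]; norm_num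
    rw [hu_eq, hpi1] at e1
    rw [hcu_eq, hpi2] at e2
    have hlog : Complex.log (conj u) = Complex.log u - 2 * u.arg * Complex.I := by
      rw [Complex.log, Complex.log, Complex.norm_conj, Complex.arg_conj,
        if_neg (Complex.mem_slitPlane_iff_arg.1 hslit).1]
      push_cast; ring
    rw [hlog]
    have hle : Real.exp u.re * (Real.pi - u.arg) ≤ Real.exp u.re * Real.pi := by
      gcongr; linarith
    calc _ = ‖((Φ (‖u‖ * -1) + (-1 : ℝ) * Real.pi * Complex.I) -
          (Φ (conj u) + (-1 : ℝ) * u.arg * Complex.I)) -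
          ((Φ (‖u‖ * -1) + (1 : ℝ) * Real.pi * Complex.I) -
          (Φ u + (1 : ℝ) * u.arg * Complex.I))‖ := by
          congr 1; push_cast; ring
      _ ≤ Real.exp u.re * Real.pi + Real.exp u.re * Real.pi :=
        (norm_sub_le _ _).trans (add_le_add (e2.trans hle) (e1.trans hle))
      _ = _ := by ring
  have h3 := tendsto_nhds_unique h1 h2
  rw [hankelIntegral, h3, smul_eq_mul, inv_mul_cancel₀ Complex.two_pi_I_ne_zero]

end Contour

end

section

/-! ### Sectors -/

/-- The open sector `{w ≠ 0 : |arg w| < β}` with vertex `0`, for semi-angles `β ≤ π`. -/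
def sector (β : ℝ) : Set ℂ := {w | w ≠ 0 ∧ |w.arg| < β}

lemma isOpen_sector {β : ℝ} (hβ : β ≤ Real.pi) : IsOpen (sector β) := by
  refine isOpen_iff_mem_nhds.2 fun w hw => ?_
  have hslit : w ∈ Complex.slitPlane := by
    rw [Complex.mem_slitPlane_iff_arg]
    refine ⟨fun h => ?_, hw.1⟩
    have := hw.2
    rw [h, abs_of_pos Real.pi_pos] at this
    linarith
  filter_upwards [isOpen_ne.mem_nhds hw.1,
    (Complex.continuousAt_arg hslit).abs.eventually_lt continuousAt_const hw.2] with v h1 h2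
  exact ⟨h1, h2⟩

lemma div_mem_sector {u z : ℂ} {α η β : ℝ} (hu : u ≠ 0) (hu' : |u.arg| ≤ α) (hz : z ∈ sector η)
    (hsum : α + η ≤ β) (hβ : β ≤ Real.pi) : u / z ∈ sector β := by
  refine ⟨div_ne_zero hu hz.1, ?_⟩
  have h1 := abs_le.1 hu'
  have h2 := abs_lt.1 hz.2
  have hzpi : z.arg ≠ Real.pi := by
    have := (abs_nonneg _).trans hu'
    linarith
  have hinv : (z⁻¹).arg = -z.arg := by rw [Complex.arg_inv, if_neg hzpi]
  rw [div_eq_mul_inv, Complex.arg_mul hu (inv_ne_zero hz.1)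
    (by rw [hinv]; constructor <;> linarith), hinv, abs_lt]
  constructor <;> linarith

lemma ofReal_mem_sector {β t : ℝ} (hβ : 0 < β) (ht : 0 < t) : (t : ℂ) ∈ sector β :=
  ⟨by exact_mod_cast ht.ne', by rwa [Complex.arg_ofReal_of_nonneg ht.le, abs_zero]⟩

/-! ### The holomorphic semigroup of a sectorial resolvent -/

section Sectorial

variable {𝔸 : Type*} [NormedRing 𝔸] [NormedAlgebra ℂ 𝔸]

/-- `G` satisfies the resolvent identity of `G(w) = (w + B)⁻¹` and the bound `‖w G(w)‖ ≤ M` on the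
sector of semi-angle `β`. -/
structure IsSectorialResolvent (β M : ℝ) (G : ℂ → 𝔸) : Prop where
  sub_eq : ∀ w ∈ sector β, ∀ v ∈ sector β, G w - G v = (v - w) • (G w * G v)
  bound : ∀ w ∈ sector β, ‖w • G w‖ ≤ M

namespace IsSectorialResolvent

variable {β M : ℝ} {G : ℂ → 𝔸} (hG : IsSectorialResolvent β M G)
include hG

lemma commute {w v : ℂ} (hw : w ∈ sector β) (hv : v ∈ sector β) : Commute (G w) (G v) := by
  by_cases h : v - w = 0
  · rw [sub_eq_zero.1 h]
  · have h1 := hG.sub_eq w hw v hv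
    have h2 := hG.sub_eq v hv w hw
    have h3 : (v - w) • (G w * G v) = (v - w) • (G v * G w) := by
      rw [← h1, ← neg_sub, h2, ← neg_smul, neg_sub]
    exact smul_right_injective 𝔸 h h3

lemma norm_le {w : ℂ} (hw : w ∈ sector β) : ‖G w‖ ≤ M / ‖w‖ := by
  have := hG.bound w hw
  rw [norm_smul] at this
  rw [le_div_iff₀ (norm_pos_iff.2 hw.1), mul_comm]
  exact this

lemma continuousAt (hβ : β ≤ Real.pi) {w : ℂ} (hw : w ∈ sector β) : ContinuousAt G w := by
  have hw0 : 0 < ‖w‖ := norm_pos_iff.2 hw.1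
  rw [ContinuousAt, tendsto_iff_norm_sub_tendsto_zero]
  have hlim : Tendsto (fun v => ‖w - v‖ * (M / ‖v‖ * (M / ‖w‖))) (𝓝 w) (𝓝 0) := by
    have : ContinuousAt (fun v => ‖w - v‖ * (M / ‖v‖ * (M / ‖w‖))) w := by
      refine ContinuousAt.mul (by fun_prop) (ContinuousAt.mul ?_ continuousAt_const)
      exact continuousAt_const.div continuous_norm.continuousAt hw0.ne'
    simpa [ContinuousAt] using this
  refine squeeze_zero' (Eventually.of_forall fun _ => norm_nonneg _) ?_ hlim
  filter_upwards [(isOpen_sector hβ).mem_nhds hw] with v hv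
  rw [hG.sub_eq v hv w hw, norm_smul]
  gcongr
  refine (norm_mul_le _ _).trans ?_
  have := hG.norm_le hv
  have := hG.norm_le hw
  gcongr
  exact (norm_nonneg _).trans (hG.norm_le hv)

lemma hasDerivAt (hβ : β ≤ Real.pi) {w : ℂ} (hw : w ∈ sector β) :
    HasDerivAt G (-(G w * G w)) w := by
  rw [hasDerivAt_iff_tendsto_slope]
  have h : Tendsto (fun v => -(G v * G w)) (𝓝[≠] w) (𝓝 (-(G w * G w))) :=
    (((hG.continuousAt hβ hw).mul continuousAt_const).neg).tendsto.mono_left nhdsWithin_le_nhds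
  refine h.congr' ?_
  filter_upwards [self_mem_nhdsWithin,
    nhdsWithin_le_nhds ((isOpen_sector hβ).mem_nhds hw)] with v hne hv
  have h0 : v - w ≠ 0 := sub_ne_zero.2 hne
  rw [slope_def_module, hG.sub_eq v hv w hw, smul_smul, ← neg_sub v w, mul_neg,
    inv_mul_cancel₀ h0, neg_smul, one_smul]

/-- The derivative of `w G(w)` is `w⁻¹ (w G(w) - (w G(w))²)`. -/
lemma hasDerivAt_smul (hβ : β ≤ Real.pi) {w : ℂ} (hw : w ∈ sector β) :
    HasDerivAt (fun w => w • G w) (w⁻¹ • (w • G w - (w • G w) * (w • G w))) w := by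
  refine ((hasDerivAt_id w).smul (hG.hasDerivAt hβ hw)).congr_deriv ?_
  have := hw.1
  simp only [id, smul_sub, smul_mul_assoc, mul_smul_comm, smul_smul, smul_neg, one_smul]
  rw [inv_mul_cancel₀ this, one_smul, inv_mul_cancel_left₀ this]
  abel

end IsSectorialResolvent

/-- The Dunford integral `(2πi)⁻¹ ∫ exp(λ z) G(λ) dλ` for `exp(-z B)`, where `G(λ) = (λ + B)⁻¹`.
The substitution `λ = u / z` keeps the contour fixed, with the bounded function
`w ↦ w G(w)` evaluated at `w = u / z`. -/
def dunfordIntegral (e : ℂ) (G : ℂ → 𝔸) (z : ℂ) : 𝔸 :=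
  hankelIntegral e fun u => (Complex.exp u / u) • ((u / z) • G (u / z))

/-- The derivative of `dunfordIntegral`. -/
def dunfordDeriv (e : ℂ) (G : ℂ → 𝔸) (z : ℂ) : 𝔸 :=
  hankelIntegral e fun u => (Complex.exp u / z) • ((u / z) • G (u / z))

namespace IsSectorialResolvent

variable {β M η : ℝ} {G : ℂ → 𝔸} {e : ℂ} (hG : IsSectorialResolvent β M G)
  (he : IsHankelDirection e) (hsum : e.arg + η ≤ β) (hβ : β ≤ Real.pi)
include hG he hsum hβ

omit hG in
lemma div_mem {u z : ℂ} (hu : u ∈ hankelContour e) (hz : z ∈ sector η) : u / z ∈ sector β :=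
  div_mem_sector (he.ne_zero hu) (he.abs_arg_le hu) hz hsum hβ

lemma continuousOn_contour {z : ℂ} (hz : z ∈ sector η) :
    ContinuousOn (fun u => (u / z) • G (u / z)) (hankelContour e) := by
  intro u hu
  have h := (hG.hasDerivAt_smul hβ (div_mem he hsum hβ hu hz)).continuousAt
  exact (h.comp (f := fun u : ℂ => u / z) (by fun_prop)).continuousWithinAt

lemma expBoundedOn_dunford {z : ℂ} (hz : z ∈ sector η) :
    ExpBoundedOn (M / e.im) (fun u => (Complex.exp u / u) • ((u / z) • G (u / z)))
      (hankelContour e) := by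
  refine ⟨(Complex.continuous_exp.continuousOn.div continuousOn_id fun u hu => he.ne_zero hu).smul
    (hG.continuousOn_contour he hsum hβ hz), fun u hu => ?_⟩
  rw [norm_smul, norm_div, Complex.norm_exp]
  have h1 := he.im_le_norm hu
  have h2 := he.im_pos
  have h3 := hG.bound _ (div_mem he hsum hβ hu hz)
  have h4 : 0 ≤ M := (norm_nonneg _).trans h3
  calc _ ≤ Real.exp u.re / e.im * M := by gcongr
    _ = _ := by ring

lemma expBoundedOn_dunfordDeriv {z : ℂ} (hz : z ∈ sector η) :
    ExpBoundedOn (M / ‖z‖) (fun u => (Complex.exp u / z) • ((u / z) • G (u / z)))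
      (hankelContour e) := by
  refine ⟨(Complex.continuous_exp.continuousOn.div_const _).smul
    (hG.continuousOn_contour he hsum hβ hz), fun u hu => ?_⟩
  rw [norm_smul, norm_div, Complex.norm_exp]
  have h3 := hG.bound _ (div_mem he hsum hβ hu hz)
  calc _ ≤ Real.exp u.re / ‖z‖ * M := by gcongr
    _ = _ := by ring

lemma norm_dunfordIntegral_le {z : ℂ} (hz : z ∈ sector η) :
    ‖dunfordIntegral e G z‖ ≤ M / e.im * hankelConst e :=
  he.norm_hankelIntegral_le (hG.expBoundedOn_dunford he hsum hβ hz)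

lemma norm_dunfordDeriv_le {z : ℂ} (hz : z ∈ sector η) :
    ‖dunfordDeriv e G z‖ ≤ M / ‖z‖ * hankelConst e :=
  he.norm_hankelIntegral_le (hG.expBoundedOn_dunfordDeriv he hsum hβ hz)

/-- Differentiation under the integral gives an integrand that differs from the one of
`dunfordDeriv` by the total derivative of `u ↦ z⁻¹ exp(u) (u / z) G(u / z)`. -/
lemma hasDerivAt_dunfordIntegral [CompleteSpace 𝔸] (hη : η ≤ Real.pi) {z : ℂ}
    (hz : z ∈ sector η) : HasDerivAt (dunfordIntegral e G) (dunfordDeriv e G z) z := by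
  set F : ℂ → 𝔸 := fun w => w • G w with hF
  have hF' : ∀ w ∈ sector β, HasDerivAt F (w⁻¹ • (F w - F w * F w)) w :=
    fun w hw => hG.hasDerivAt_smul hβ hw
  have hFb : ∀ w ∈ sector β, ‖F w‖ ≤ M := hG.bound
  have hz0 : 0 < ‖z‖ := norm_pos_iff.2 hz.1
  set s : Set ℂ := sector η ∩ {v | ‖z‖ / 2 < ‖v‖} with hs_def
  have hs : s ∈ 𝓝 z := inter_mem ((isOpen_sector hη).mem_nhds hz)
    ((isOpen_lt continuous_const continuous_norm).mem_nhds (half_lt_self hz0))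
  -- the part `-(uv)⁻¹ exp(u) (F - F²)(u / v)` of the derivatives in `u` and `v`
  let g : ℂ → ℂ → 𝔸 := fun v u =>
    (-(Complex.exp u / (u * v))) • (F (u / v) - F (u / v) * F (u / v))
  have hg : ∀ v ∈ s, ExpBoundedOn ((M + M * M) / (e.im * (‖z‖ / 2))) (g v) (hankelContour e) := by
    intro v hv
    have hc : ContinuousOn (fun u => F (u / v)) (hankelContour e) :=
      hG.continuousOn_contour he hsum hβ hv.1
    refine ⟨?_, fun u hu => ?_⟩
    · refine ContinuousOn.smul (ContinuousOn.neg (Complex.continuous_exp.continuousOn.div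
        (by fun_prop) fun u hu => mul_ne_zero (he.ne_zero hu) hv.1.1)) (hc.sub (hc.mul hc))
    · have h1 := he.im_le_norm hu
      have h2 := he.im_pos
      have h3 := hFb _ (div_mem he hsum hβ hu hv.1)
      have h4 : 0 ≤ M := (norm_nonneg _).trans h3
      have h5 : ‖F (u / v) - F (u / v) * F (u / v)‖ ≤ M + M * M :=
        (norm_sub_le _ _).trans (add_le_add h3 ((norm_mul_le _ _).trans (by gcongr)))
      have h6 : ‖z‖ / 2 ≤ ‖v‖ := le_of_lt hv.2
      rw [norm_smul, norm_neg, norm_div, norm_mul, Complex.norm_exp]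
      calc _ ≤ Real.exp u.re / (e.im * (‖z‖ / 2)) * (M + M * M) := by gcongr
        _ = _ := by ring
  have hderiv : HasDerivAt (dunfordIntegral e G) (hankelIntegral e (g z)) z := by
    refine he.hasDerivAt_hankelIntegral hs
      (fun v hv => hG.expBoundedOn_dunford he hsum hβ hv.1) hg fun v hv u hu => ?_
    have hu0 := he.ne_zero hu
    have hv0 := hv.1.1
    have h1 : HasDerivAt (fun v : ℂ => u / v) (-(u / v ^ 2)) v := by
      simpa [div_eq_mul_inv] using (hasDerivAt_inv hv0).const_mul u
    refine (((hF' _ (div_mem he hsum hβ hu hv.1)).scomp v h1).const_smul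
      (Complex.exp u / u)).congr_deriv ?_
    simp only [g, smul_smul]
    congr 1
    field_simp
  have hparts : hankelIntegral e (fun u => (Complex.exp u / z) • F (u / z) - g z u) = 0 := by
    refine he.hankelIntegral_deriv_eq_zero
      (C := M / ‖z‖ + (M + M * M) / (e.im * (‖z‖ / 2))) (C' := M / ‖z‖)
      (f := fun u => (Complex.exp u / z) • F (u / z)) (fun u hu => ?_)
      ((hG.expBoundedOn_dunfordDeriv he hsum hβ hz).sub (hg z (mem_of_mem_nhds hs)))
      (hG.expBoundedOn_dunfordDeriv he hsum hβ hz).norm_le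
    have hu0 := he.ne_zero hu
    have h1 : HasDerivAt (fun u : ℂ => u / z) (1 / z) u := (hasDerivAt_id u).div_const z
    have h2 := (hF' _ (div_mem he hsum hβ hu hz)).scomp u h1
    refine (((Complex.hasDerivAt_exp u).div_const z).smul h2).congr_deriv ?_
    rw [add_comm]
    simp only [g, smul_smul, neg_smul, sub_neg_eq_add]
    congr 2
    have := hz.1
    field_simp
  rw [he.hankelIntegral_sub (hG.expBoundedOn_dunfordDeriv he hsum hβ hz)
    (hg z (mem_of_mem_nhds hs)), sub_eq_zero] at hparts
  rw [dunfordDeriv, hparts]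
  exact hderiv

/-- The generator acts on the Dunford integral as minus the derivative; written with a resolvent
value `G(μ)` in place of the generator. -/
lemma mul_sub_dunfordDeriv [CompleteSpace 𝔸] {z μ : ℂ} (hz : z ∈ sector η) (hμ : μ ∈ sector β) :
    G μ * (μ • dunfordIntegral e G z - dunfordDeriv e G z) = dunfordIntegral e G z := by
  set L : 𝔸 →L[ℂ] 𝔸 := ContinuousLinearMap.mul ℂ 𝔸 (G μ) with hL
  have ha := hG.expBoundedOn_dunford he hsum hβ hz
  have hb := hG.expBoundedOn_dunfordDeriv he hsum hβ hz
  have h1 := he.hankelIntegral_clm_comp (μ • L) ha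
  have h2 := he.hankelIntegral_clm_comp L hb
  have h3 := he.hankelIntegral_sub ((ha.clm_comp (μ • L)).sub (hb.clm_comp L)) ha
  rw [he.hankelIntegral_sub (ha.clm_comp (μ • L)) (hb.clm_comp L), h1, h2] at h3
  have h4 : hankelIntegral e (fun u => (Complex.exp u) • (-(z⁻¹ • G μ))) = 0 := by
    have hE : ExpBoundedOn ‖-(z⁻¹ • G μ)‖ (fun u => (Complex.exp u) • (-(z⁻¹ • G μ)))
        (hankelContour e) := by
      refine ⟨by fun_prop, fun u _ => ?_⟩
      rw [norm_smul, Complex.norm_exp, mul_comm]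
    exact he.hankelIntegral_deriv_eq_zero
      (fun u _ => (Complex.hasDerivAt_exp u).smul_const _) hE hE.norm_le
  have h5 : (μ • L) (dunfordIntegral e G z) - L (dunfordDeriv e G z) - dunfordIntegral e G z =
      0 := by
    rw [dunfordIntegral, dunfordDeriv, ← h3, ← h4]
    refine hankelIntegral_congr fun u hu => ?_
    have hu0 := he.ne_zero hu
    have hz0 := hz.1
    -- the resolvent identity, multiplied by `w = u / z`
    have h6 := hG.sub_eq μ hμ _ (div_mem he hsum hβ hu hz)
    have h7 : G (u / z) = G μ - (u / z - μ) • (G μ * G (u / z)) := by rw [← h6]; abel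
    simp only [hL, smul_apply, ContinuousLinearMap.mul_apply', mul_smul_comm,
      smul_smul]
    conv_lhs =>
      enter [2]
      rw [h7]
    rw [smul_sub, smul_smul, smul_neg, smul_smul]
    have e1 : Complex.exp u / u * (u / z) = Complex.exp u * z⁻¹ := by field_simp
    rw [e1]
    have e2 : μ * (Complex.exp u * z⁻¹) - Complex.exp u / z * (u / z) +
        Complex.exp u * z⁻¹ * (u / z - μ) = 0 := by field_simp; ring
    rw [sub_sub_eq_add_sub, ← sub_smul, ← add_smul, e2, zero_smul, zero_sub]
  have h8 := sub_eq_zero.1 h5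
  rw [mul_sub, mul_smul_comm]
  exact h8

lemma commute_dunfordIntegral [CompleteSpace 𝔸] {z μ : ℂ} (hz : z ∈ sector η)
    (hμ : μ ∈ sector β) : Commute (G μ) (dunfordIntegral e G z) := by
  have hb := hG.expBoundedOn_dunford he hsum hβ hz
  have h1 := he.hankelIntegral_clm_comp (ContinuousLinearMap.mul ℂ 𝔸 (G μ)) hb
  have h2 := he.hankelIntegral_clm_comp ((ContinuousLinearMap.mul ℂ 𝔸).flip (G μ)) hb
  simp only [ContinuousLinearMap.mul_apply', ContinuousLinearMap.flip_apply] at h1 h2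
  rw [Commute, SemiconjBy, dunfordIntegral, ← h1, ← h2]
  refine hankelIntegral_congr fun u hu => ?_
  simp only [mul_smul_comm, smul_mul_assoc]
  rw [hG.commute hμ (div_mem he hsum hβ hu hz)]

/-- On the range of a resolvent value, the Dunford integral tends to `1` as `z → 0`. -/
lemma norm_dunfordIntegral_mul_sub_le [CompleteSpace 𝔸] {z μ : ℂ} (hz : z ∈ sector η)
    (hμ : μ ∈ sector β) :
    ‖dunfordIntegral e G z * G μ - G μ‖ ≤
      ‖z‖ * ((‖μ‖ * M * ‖G μ‖ + M) / e.im ^ 2 * hankelConst e) := by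
  have ha := hG.expBoundedOn_dunford he hsum hβ hz
  have h1 := he.hankelIntegral_clm_comp ((ContinuousLinearMap.mul ℂ 𝔸).flip (G μ)) ha
  have hE := he.expBoundedOn_exp_div
  have h2 := he.hankelIntegral_clm_comp (ContinuousLinearMap.toSpanSingleton ℂ (G μ)) hE
  have h3 := he.hankelIntegral_sub (ha.clm_comp ((ContinuousLinearMap.mul ℂ 𝔸).flip (G μ)))
    (hE.clm_comp (ContinuousLinearMap.toSpanSingleton ℂ (G μ)))
  rw [h1, h2, he.hankelIntegral_exp_div] at h3
  simp only [ContinuousLinearMap.mul_apply', ContinuousLinearMap.flip_apply,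
    ContinuousLinearMap.toSpanSingleton_apply, one_smul] at h3
  rw [dunfordIntegral, ← h3]
  have hbd : ExpBoundedOn (‖z‖ * ((‖μ‖ * M * ‖G μ‖ + M) / e.im ^ 2))
      (fun u => (Complex.exp u / u) • ((u / z) • G (u / z)) * G μ - (Complex.exp u / u) • G μ)
      (hankelContour e) := by
    refine ⟨((ha.clm_comp ((ContinuousLinearMap.mul ℂ 𝔸).flip (G μ))).sub
      (hE.clm_comp (ContinuousLinearMap.toSpanSingleton ℂ (G μ)))).continuousOn, fun u hu => ?_⟩
    have hu0 := he.ne_zero hu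
    have hz0 := hz.1
    have hw := div_mem he hsum hβ hu hz
    have h4 := hG.sub_eq _ hw μ hμ
    have hFb := hG.bound _ hw
    have hM : 0 ≤ M := (norm_nonneg _).trans hFb
    -- `w G(w) G(μ) - G(μ) = w⁻¹ (μ w G(w) G(μ) - w G(w))` for `w = u / z`
    have h5 : (u / z) • G (u / z) * G μ - G μ =
        (z / u) • (μ • (((u / z) • G (u / z)) * G μ) - (u / z) • G (u / z)) := by
      have h6 : G μ = G (u / z) - (μ - u / z) • (G (u / z) * G μ) := by rw [← h4]; abel
      conv_lhs =>
        enter [2]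
        rw [h6]
      simp only [smul_mul_assoc, smul_sub, smul_smul]
      have e1 : z / u * (u / z) = 1 := by field_simp
      have e2 : z / u * (μ * (u / z)) = μ := by field_simp
      rw [e1, e2, one_smul, sub_smul]
      abel
    rw [smul_mul_assoc, ← smul_sub, h5, norm_smul, norm_smul, norm_div, norm_div,
      Complex.norm_exp]
    have h6 := he.im_le_norm hu
    have h7 := he.im_pos
    have h8 : ‖μ • (((u / z) • G (u / z)) * G μ) - (u / z) • G (u / z)‖ ≤
        ‖μ‖ * M * ‖G μ‖ + M := by
      refine (norm_sub_le _ _).trans (add_le_add ?_ hFb)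
      rw [norm_smul, mul_assoc]
      gcongr
      exact (norm_mul_le _ _).trans (by gcongr)
    calc _ ≤ Real.exp u.re / e.im * (‖z‖ / e.im * (‖μ‖ * M * ‖G μ‖ + M)) := by gcongr
      _ = _ := by field_simp
  refine (he.norm_hankelIntegral_le hbd).trans_eq ?_
  ring

end IsSectorialResolvent

end Sectorial

end

section

/-! ### The open sector and the identity theorem -/

lemma openSector_eq_sector {θ : ℝ} (hθ : θ ≤ Real.pi / 2) : openSector θ = sector θ := by
  ext z
  constructor
  · rintro ⟨h1, h2⟩
    exact ⟨fun h => by simp [h] at h1, h2⟩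
  · rintro ⟨h1, h2⟩
    exact ⟨(Complex.abs_arg_lt_pi_div_two_iff.1 (h2.trans_le hθ)).resolve_right h1, h2⟩

lemma mem_openSector_iff {θ : ℝ} (hθ : 0 < θ) (hθ' : θ ≤ Real.pi / 2) {z : ℂ} :
    z ∈ openSector θ ↔ 0 < z.re ∧ |z.im| * Real.cos θ < z.re * Real.sin θ := by
  refine and_congr_right fun hre => ?_
  have hz : 0 < ‖z‖ := norm_pos_iff.2 fun h => by simp [h] at hre
  have harg : |z.arg| < Real.pi / 2 := Complex.abs_arg_lt_pi_div_two_iff.2 (.inl hre)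
  have h : z.re * Real.sin θ - |z.im| * Real.cos θ = ‖z‖ * Real.sin (θ - |z.arg|) := by
    rw [← Complex.norm_mul_cos_arg z, ← Complex.norm_mul_sin_arg z, abs_mul, abs_norm,
      Real.abs_sin_eq_sin_abs_of_abs_le_pi (by linarith [Real.pi_pos]), Real.sin_sub,
      Real.cos_abs]
    ring
  rw [← sub_pos (a := z.re * _), h, mul_pos_iff_of_pos_left hz]
  constructor
  · intro h'
    exact Real.sin_pos_of_pos_of_lt_pi (by linarith) (by linarith [abs_nonneg z.arg, Real.pi_pos])
  · intro h'
    by_contra hcon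
    exact absurd h' (not_lt.2 (Real.sin_nonpos_of_nonpos_of_neg_pi_le (by linarith)
      (by linarith [Real.pi_pos])))

lemma add_mem_openSector {θ : ℝ} (hθ : 0 < θ) (hθ' : θ ≤ Real.pi / 2) {z w : ℂ}
    (hz : z ∈ openSector θ) (hw : w ∈ openSector θ) : z + w ∈ openSector θ := by
  rw [mem_openSector_iff hθ hθ'] at *
  refine ⟨add_pos hz.1 hw.1, ?_⟩
  have hcos : 0 ≤ Real.cos θ := Real.cos_nonneg_of_neg_pi_div_two_le_of_le (by linarith) hθ'
  have := mul_le_mul_of_nonneg_right (abs_add_le z.im w.im) hcos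
  rw [Complex.add_im, Complex.add_re]
  linarith [hz.2, hw.2]

lemma ofReal_mul_mem_openSector {θ : ℝ} {z : ℂ} (hz : z ∈ openSector θ) {t : ℝ} (ht : 0 < t) :
    (t : ℂ) * z ∈ openSector θ :=
  ⟨by rw [Complex.re_ofReal_mul]; exact mul_pos ht hz.1, by
    rw [Complex.arg_real_mul _ ht]; exact hz.2⟩

lemma ofReal_mem_openSector {θ : ℝ} (hθ : 0 < θ) {t : ℝ} (ht : 0 < t) : (t : ℂ) ∈ openSector θ :=
  ⟨by simpa using ht, by rwa [Complex.arg_ofReal_of_nonneg ht.le, abs_zero]⟩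

lemma convex_openSector {θ : ℝ} (hθ : 0 < θ) (hθ' : θ ≤ Real.pi / 2) :
    Convex ℝ (openSector θ) := by
  rw [convex_iff_forall_pos]
  intro z hz w hw a b ha hb _
  rw [Complex.real_smul, Complex.real_smul]
  exact add_mem_openSector hθ hθ' (ofReal_mul_mem_openSector hz ha)
    (ofReal_mul_mem_openSector hw hb)

/-- Holomorphic functions on a sector are determined by their values on `(0, ∞)`. -/
lemma eqOn_openSector_of_eq_ofReal {E : Type*} [NormedAddCommGroup E] [NormedSpace ℂ E]
    [CompleteSpace E] {θ : ℝ} (hθ : 0 < θ) (hθ' : θ ≤ Real.pi / 2) {f g : ℂ → E}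
    (hf : DifferentiableOn ℂ f (openSector θ)) (hg : DifferentiableOn ℂ g (openSector θ))
    (h : ∀ t : ℝ, 0 < t → f t = g t) : Set.EqOn f g (openSector θ) := by
  have hopen : IsOpen (openSector θ) := by
    rw [openSector_eq_sector hθ']
    exact isOpen_sector (by linarith [Real.pi_pos])
  refine (hf.analyticOnNhd hopen).eqOn_of_preconnected_of_frequently_eq (hg.analyticOnNhd hopen)
    (convex_openSector hθ hθ').isPreconnected (ofReal_mem_openSector hθ one_pos) ?_
  have ht : Tendsto (fun t : ℝ => (t : ℂ)) (𝓝[≠] 1) (𝓝[≠] ((1 : ℝ) : ℂ)) :=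
    tendsto_nhdsWithin_iff.2 ⟨Complex.continuous_ofReal.continuousAt.tendsto.mono_left
      nhdsWithin_le_nhds, eventually_mem_nhdsWithin.mono fun t ht => by
        simpa using ht⟩
  refine ht.frequently (Eventually.frequently ?_)
  exact nhdsWithin_le_nhds ((lt_mem_nhds one_pos).mono fun t ht => h t ht)

/-! ### Resolvents of unbounded operators -/

variable {H : Type*} [NormedAddCommGroup H] [InnerProductSpace ℂ H]

namespace IsResolventAt

variable {A : H →ₗ.[ℂ] H} {z z' : ℂ} {R R' : H →L[ℂ] H}

lemma mem_graph (h : IsResolventAt A z R) (x : H) : (R x, x + z • R x) ∈ A.graph := by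
  rw [LinearPMap.mem_graph_iff]
  refine ⟨⟨R x, h.mem_domain x⟩, rfl, ?_⟩
  rw [← sub_eq_iff_eq_add]
  exact h.right_inv x

lemma apply_of_mem_graph (h : IsResolventAt A z R) {x y : H} (hxy : (x, y) ∈ A.graph) :
    R (y - z • x) = x := by
  rw [LinearPMap.mem_graph_iff] at hxy
  obtain ⟨x', rfl, rfl⟩ := hxy
  exact h.left_inv x'

/-- The resolvent identity. -/
lemma sub_eq (h : IsResolventAt A z R) (h' : IsResolventAt A z' R') :
    R - R' = (z - z') • (R * R') := by
  ext x
  have h1 := h.apply_of_mem_graph (h'.mem_graph x)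
  rw [add_sub_assoc, ← sub_smul, map_add, map_smul] at h1
  simp only [sub_apply, smul_apply, mul_apply_eq_comp]
  rw [sub_eq_iff_eq_add]
  nth_rewrite 2 [← h1]
  rw [add_left_comm, ← add_smul]
  simp

lemma unique (h : IsResolventAt A z R) (h' : IsResolventAt A z R') : R = R' := by
  have := h.sub_eq h'
  rwa [sub_self, zero_smul, sub_eq_zero] at this

lemma injective (h : IsResolventAt A z R) : Function.Injective R := by
  refine (injective_iff_map_eq_zero _).2 fun x hx => ?_
  have h1 := h.mem_graph x
  rw [hx, smul_zero, add_zero] at h1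
  exact A.graph_fst_eq_zero_snd h1 rfl

end IsResolventAt

open Classical in
/-- The resolvent `(A - z)⁻¹`, or `0` if `z` is not in the resolvent set. -/
def resolventAt (A : H →ₗ.[ℂ] H) (z : ℂ) : H →L[ℂ] H :=
  if h : z ∈ resolventSet A then h.choose else 0

lemma isResolventAt_resolventAt {A : H →ₗ.[ℂ] H} {z : ℂ} (h : z ∈ resolventSet A) :
    IsResolventAt A z (resolventAt A z) := by
  rw [resolventAt, dif_pos h]
  exact h.choose_spec

/-- The shifted resolvent `w ↦ (w + ω₀ + A)⁻¹`. -/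
def shiftedResolvent (A : H →ₗ.[ℂ] H) (ω₀ : ℝ) (w : ℂ) : H →L[ℂ] H :=
  resolventAt A (-(w + ω₀))

namespace HolomorphicClass

variable {θ ω₀ : ℝ} {A : H →ₗ.[ℂ] H} (hA : HolomorphicClass θ ω₀ A)
include hA

lemma exists_resolvent_bound {ε : ℝ} (hε : 0 < ε) (hεθ : ε < θ) : ∃ M : ℝ, 0 < M ∧
    ∀ w ∈ sector (Real.pi / 2 + (θ - ε)),
      IsResolventAt A (-(w + ω₀)) (shiftedResolvent A ω₀ w) ∧
        ‖w • shiftedResolvent A ω₀ w‖ ≤ M := by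
  obtain ⟨M, hM, h⟩ := hA.resolvent_bound ε hε hεθ
  refine ⟨M, hM, fun w hw => ?_⟩
  obtain ⟨R, hR, hRM⟩ := h (w + ω₀) (by
    rw [closedSector, Set.mem_ofPred_eq, add_sub_cancel_right]; exact hw.2.le) (by simpa using hw.1)
  have h1 := isResolventAt_resolventAt ⟨R, hR⟩
  refine ⟨h1, ?_⟩
  rw [add_sub_cancel_right] at hRM
  rw [shiftedResolvent, h1.unique hR, norm_smul]
  have hw0 : 0 < ‖w‖ := norm_pos_iff.2 hw.1
  calc ‖w‖ * ‖R‖ ≤ ‖w‖ * (M * ‖w‖⁻¹) := by gcongr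
    _ = M := by field_simp

lemma isResolventAt {ε : ℝ} (hε : 0 < ε) (hεθ : ε < θ) {w : ℂ}
    (hw : w ∈ sector (Real.pi / 2 + (θ - ε))) :
    IsResolventAt A (-(w + ω₀)) (shiftedResolvent A ω₀ w) :=
  ((hA.exists_resolvent_bound hε hεθ).choose_spec.2 w hw).1

lemma exists_isSectorialResolvent {ε : ℝ} (hε : 0 < ε) (hεθ : ε < θ) : ∃ M : ℝ, 0 < M ∧
    IsSectorialResolvent (Real.pi / 2 + (θ - ε)) M (shiftedResolvent A ω₀) := by
  obtain ⟨M, hM, h⟩ := hA.exists_resolvent_bound hε hεθ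
  refine ⟨M, hM, fun w hw v hv => ?_, fun w hw => (h w hw).2⟩
  rw [(h w hw).1.sub_eq (h v hv).1]
  congr 1
  ring

end HolomorphicClass

/-! ### Strongly continuous semigroups -/

namespace IsC0Semigroup

variable {T : ℝ → H →L[ℂ] H} (hT : IsC0Semigroup T)
include hT

lemma tendsto_zero_Ici (x : H) : Tendsto (fun t : ℝ => T t x) (𝓝[≥] 0) (𝓝 x) := by
  rw [← Set.Ioi_insert, nhdsWithin_insert, tendsto_sup]
  refine ⟨?_, hT.tendsto_zero x⟩
  rw [tendsto_pure_left]
  intro s hs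
  rw [hT.map_zero]
  exact mem_of_mem_nhds hs

lemma map_nsmul {t : ℝ} (ht : 0 ≤ t) (n : ℕ) : T (n * t) = T t ^ n := by
  induction n with
  | zero => simp [hT.map_zero]
  | succ n ih =>
    rw [pow_succ, ← ih, ← hT.map_add _ _ (by positivity) ht]
    congr 1
    push_cast
    ring

variable [CompleteSpace H]

lemma exists_bound_near_zero : ∃ δ M : ℝ, 0 < δ ∧ 1 ≤ M ∧
    ∀ t : ℝ, 0 ≤ t → t ≤ δ → ‖T t‖ ≤ M := by
  by_contra! hcon
  choose! t ht0 ht1 htM using fun n : ℕ =>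
    hcon (1 / ((n : ℝ) + 1)) ((n : ℝ) + 1) (by positivity) (by simp)
  have htlim : Tendsto t atTop (𝓝[≥] 0) := tendsto_nhdsWithin_iff.2
    ⟨squeeze_zero ht0 ht1 tendsto_one_div_add_atTop_nhds_zero_nat, Eventually.of_forall ht0⟩
  obtain ⟨C, hC⟩ := banach_steinhaus (g := fun n => T (t n)) fun x => by
    obtain ⟨C, hC⟩ := ((hT.tendsto_zero_Ici x).comp htlim).norm.bddAbove_range
    exact ⟨C, fun n => hC ⟨n, rfl⟩⟩
  obtain ⟨n, hn⟩ := exists_nat_gt C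
  linarith [hC n, htM n]

lemma exists_bound (a : ℝ) : ∃ M : ℝ, 0 ≤ M ∧ ∀ t : ℝ, 0 ≤ t → t ≤ a → ‖T t‖ ≤ M := by
  obtain ⟨δ, M, hδ, hM, h⟩ := hT.exists_bound_near_zero
  obtain ⟨n, hn⟩ := exists_nat_gt (a / δ)
  refine ⟨M ^ (n + 1), by positivity, fun t ht hta => ?_⟩
  have hn' : (0 : ℝ) < (n + 1 : ℕ) := by positivity
  have h1 : T t = T (t / (n + 1 : ℕ)) ^ (n + 1) := by
    rw [← hT.map_nsmul (by positivity)]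
    congr 1
    field_simp
  rw [h1]
  refine (norm_pow_le' _ n.succ_pos).trans ?_
  gcongr
  refine h _ (by positivity) ?_
  rw [div_le_iff₀ hn']
  rw [div_lt_iff₀ hδ] at hn
  push_cast
  nlinarith

omit [CompleteSpace H] in
lemma norm_sub_apply_le {a M : ℝ} (hM : ∀ t : ℝ, 0 ≤ t → t ≤ a → ‖T t‖ ≤ M) {s t : ℝ}
    (hs : 0 ≤ s) (hst : s ≤ t) (hta : t ≤ a) (x : H) :
    ‖T t x - T s x‖ ≤ M * ‖T (t - s) x - x‖ := by
  have h : T t x - T s x = T s (T (t - s) x - x) := by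
    rw [map_sub, ← mul_apply_eq_comp, ← hT.map_add _ _ hs (sub_nonneg.2 hst), add_sub_cancel]
  rw [h]
  exact (T s).le_of_opNorm_le (hM s hs (hst.trans hta)) _

/-- Joint strong continuity. -/
lemma tendsto_apply {ι : Type*} {l : Filter ι} {h : ι → ℝ} {v : ι → H} {s : ℝ} {v₀ : H}
    (hs : 0 ≤ s) (hh₀ : ∀ᶠ i in l, 0 ≤ h i) (hh : Tendsto h l (𝓝 s)) (hv : Tendsto v l (𝓝 v₀)) :
    Tendsto (fun i => T (h i) (v i)) l (𝓝 (T s v₀)) := by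
  obtain ⟨M, hM, hb⟩ := hT.exists_bound (s + 1)
  rw [tendsto_iff_norm_sub_tendsto_zero] at hv ⊢
  have h1 : Tendsto (fun i => |h i - s|) l (𝓝[≥] 0) := by
    refine tendsto_nhdsWithin_iff.2 ⟨?_, Eventually.of_forall fun i => Set.mem_Ici.2 (abs_nonneg _)⟩
    simpa using (hh.sub_const s).abs
  have h2 := tendsto_iff_norm_sub_tendsto_zero.1 ((hT.tendsto_zero_Ici v₀).comp h1)
  refine squeeze_zero' (Eventually.of_forall fun _ => norm_nonneg _) ?_
    (by simpa only [mul_zero, add_zero] using (hv.const_mul M).add (h2.const_mul M))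
  filter_upwards [hh₀, hh.eventually (gt_mem_nhds (lt_add_one s))] with i hi0 hi1
  have h3 : T (h i) (v i) - T s v₀ = T (h i) (v i - v₀) + (T (h i) v₀ - T s v₀) := by
    rw [map_sub]; abel
  rw [h3]
  refine (norm_add_le _ _).trans (add_le_add ((T (h i)).le_of_opNorm_le (hb _ hi0 hi1.le) _) ?_)
  rcases le_total s (h i) with hle | hle
  · rw [Function.comp, abs_of_nonneg (sub_nonneg.2 hle)]
    exact hT.norm_sub_apply_le hb hs hle hi1.le v₀
  · rw [Function.comp, abs_sub_comm, abs_of_nonneg (sub_nonneg.2 hle), norm_sub_rev]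
    exact hT.norm_sub_apply_le hb hi0 hle (by linarith) v₀

end IsC0Semigroup

namespace IsGenerator

variable {A : H →ₗ.[ℂ] H} {T : ℝ → H →L[ℂ] H} (hAT : IsGenerator A T) (hT : IsC0Semigroup T)
include hAT hT

lemma apply_mem_graph {x y : H} (hxy : (x, y) ∈ A.graph) {t : ℝ} (ht : 0 ≤ t) :
    (T t x, T t y) ∈ A.graph := by
  rw [hAT] at hxy ⊢
  refine (((T t).continuous.tendsto y).comp hxy).congr' ?_
  filter_upwards [self_mem_nhdsWithin] with s hs
  have h : T s (T t x) = T t (T s x) := by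
    rw [← mul_apply_eq_comp, ← mul_apply_eq_comp, ← hT.map_add _ _ (le_of_lt hs) ht,
      ← hT.map_add _ _ ht (le_of_lt hs), add_comm]
  rw [Function.comp, map_smul, map_sub, h]

lemma commute_resolvent {z : ℂ} {R : H →L[ℂ] H} (hR : IsResolventAt A z R) {t : ℝ}
    (ht : 0 ≤ t) : Commute R (T t) := by
  ext x
  have h := hR.apply_of_mem_graph (hAT.apply_mem_graph hT (hR.mem_graph x) ht)
  rw [map_add, map_smul, add_sub_cancel_right] at h
  exact h

variable [CompleteSpace H]

/-- If `g` solves the backward equation `g' = A g` at `s`, then `s ↦ T(s) g(s)` has right derivative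
zero there. -/
lemma hasDerivWithinAt_apply_zero {g : ℝ → H} {g' : H} {s : ℝ} (hs : 0 ≤ s)
    (hg : HasDerivAt g g' s) (hgA : (g s, g') ∈ A.graph) :
    HasDerivWithinAt (fun s => T s (g s)) 0 (Set.Ici s) s := by
  rw [hasDerivWithinAt_iff_tendsto_slope, Set.Ici_sdiff_left]
  have hsub : Tendsto (fun t => t - s) (𝓝[>] s) (𝓝[>] 0) := by
    refine tendsto_nhdsWithin_iff.2 ⟨?_, ?_⟩
    · exact ((continuous_id.sub continuous_const).tendsto' s 0 (sub_self s)).mono_left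
        nhdsWithin_le_nhds
    · filter_upwards [self_mem_nhdsWithin] with t ht
      exact sub_pos.2 (Set.mem_Ioi.1 ht)
  have h1 : Tendsto (fun t => T (t - s) (slope g s t)) (𝓝[>] s) (𝓝 (T 0 g')) :=
    hT.tendsto_apply le_rfl
      ((hsub.eventually eventually_mem_nhdsWithin).mono fun t ht => le_of_lt ht)
      (hsub.mono_right nhdsWithin_le_nhds)
      ((hasDerivAt_iff_tendsto_slope.1 hg).mono_left (nhdsWithin_mono _ fun t ht => ne_of_gt ht))
  have h2 := ((hAT _ _).1 hgA).comp hsub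
  have h3 := ((T s).continuous.tendsto _).comp (h1.sub h2)
  rw [hT.map_zero, one_apply_eq_self, sub_self, map_zero] at h3
  refine h3.congr' ?_
  filter_upwards [self_mem_nhdsWithin] with t ht
  have ht' : 0 ≤ t - s := sub_nonneg.2 (le_of_lt ht)
  have h4 : T t (g t) = T s (T (t - s) (g t)) := by
    rw [← mul_apply_eq_comp, ← hT.map_add _ _ hs ht', add_sub_cancel]
  simp only [Function.comp, slope_def_module, h4]
  simp only [← Complex.coe_smul, map_sub, map_smul, smul_sub]
  abel

/-- Uniqueness for the Cauchy problem `U' = -A U`, with the generator expressed through a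
resolvent value `R` that commutes with `U`. -/
theorem eq_of_hasDerivAt {z : ℂ} {R : H →L[ℂ] H} (hR : IsResolventAt A z R)
    {U U' : ℝ → H →L[ℂ] H} (hU : ∀ t, 0 < t → HasDerivAt U (U' t) t)
    (hRU : ∀ t, 0 < t → R * U' t = -(U t + z • (R * U t)))
    (hcomm : ∀ t, 0 < t → Commute R (U t))
    (hlim : Tendsto (fun t => U t * R) (𝓝[>] 0) (𝓝 R)) {t : ℝ} (ht : 0 < t) : T t = U t := by
  ext x
  -- `g` solves `g' = A g` on `[0, t)`, so that `T s (g s)` is constant there; the inner `R` makes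
  -- `g s` converge as `s → t`
  set g : ℝ → H := fun s => R (U (t - s) (R x)) with hg
  have hderiv : ∀ s, s < t → HasDerivAt g (U (t - s) (R x) + z • g s) s := by
    intro s hs
    have hts : 0 < t - s := sub_pos.2 hs
    have h1 : HasDerivAt (fun s => R * U (t - s)) (-(R * U' (t - s))) s := by
      have h0 := (hU _ hts).scomp s ((hasDerivAt_id s).const_sub t)
      have h0' := ((ContinuousLinearMap.mul ℂ (H →L[ℂ] H) R).restrictScalars
        ℝ).hasFDerivAt.comp_hasDerivAt s h0
      refine h0'.congr_deriv ?_
      simp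
    have h2 := ((ContinuousLinearMap.apply ℂ H (R x)).restrictScalars
      ℝ).hasFDerivAt.comp_hasDerivAt s h1
    refine h2.congr_deriv ?_
    rw [hRU _ hts, neg_neg]
    rfl
  have hgA : ∀ s, (g s, U (t - s) (R x) + z • g s) ∈ A.graph := fun s => hR.mem_graph _
  have hconst : ∀ s, 0 ≤ s → s < t → T s (g s) = g 0 := by
    intro s hs hst
    have h0 := constant_of_has_deriv_right_zero (f := fun s => T s (g s)) (a := 0) (b := s)
      (fun r hr => ?_) (fun r hr => hAT.hasDerivWithinAt_apply_zero hT hr.1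
        (hderiv r (hr.2.trans hst)) (hgA r)) s ⟨hs, le_rfl⟩
    · rw [h0, hT.map_zero, one_apply_eq_self]
    · exact hT.tendsto_apply hr.1 (eventually_mem_nhdsWithin.mono fun r hr => hr.1)
        (tendsto_id.mono_left nhdsWithin_le_nhds)
        ((hderiv r (hr.2.trans_lt hst)).continuousAt.tendsto.mono_left nhdsWithin_le_nhds)
  have hgt : Tendsto g (𝓝[<] t) (𝓝 (R (R x))) := by
    have h1 : Tendsto (fun s => t - s) (𝓝[<] t) (𝓝[>] 0) := by
      refine tendsto_nhdsWithin_iff.2 ⟨?_, ?_⟩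
      · exact ((continuous_const.sub continuous_id).tendsto' t 0 (sub_self t)).mono_left
          nhdsWithin_le_nhds
      · filter_upwards [self_mem_nhdsWithin] with s hs
        exact sub_pos.2 (Set.mem_Iio.1 hs)
    have h2 := (ContinuousLinearMap.apply ℂ H x).continuous.tendsto R |>.comp (hlim.comp h1)
    exact (R.continuous.tendsto _).comp h2
  have h1 : Tendsto (fun s => T s (g s)) (𝓝[<] t) (𝓝 (T t (R (R x)))) :=
    hT.tendsto_apply ht.le (nhdsWithin_le_nhds ((lt_mem_nhds ht).mono fun _ h => h.le))
      (tendsto_id.mono_left nhdsWithin_le_nhds) hgt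
  have h2 : Tendsto (fun s => T s (g s)) (𝓝[<] t) (𝓝 (g 0)) := by
    refine tendsto_const_nhds.congr' ?_
    filter_upwards [self_mem_nhdsWithin, nhdsWithin_le_nhds (lt_mem_nhds ht)] with s hs hs0
    exact (hconst s (le_of_lt hs0) hs).symm
  have h3 := tendsto_nhds_unique h1 h2
  have hRT : ∀ y, T t (R y) = R (T t y) := fun y =>
    congrArg (fun L : H →L[ℂ] H => L y) (hAT.commute_resolvent hT hR ht.le).eq.symm
  have hRU : ∀ y, U t (R y) = R (U t y) := fun y =>
    congrArg (fun L : H →L[ℂ] H => L y) (hcomm t ht).eq.symm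
  simp only [hg, sub_zero] at h3
  rw [hRT, hRT, hRU] at h3
  exact hR.injective (hR.injective h3)

end IsGenerator

end

section

/-! ### The holomorphic extension -/

lemma norm_exp_mul_le (ω₀ : ℝ) (z : ℂ) : ‖Complex.exp (ω₀ * z)‖ ≤ Real.exp (|ω₀| * ‖z‖) := by
  rw [Complex.norm_exp]
  refine Real.exp_le_exp.2 ((Complex.re_le_norm _).trans_eq ?_)
  rw [norm_mul, Complex.norm_real, Real.norm_eq_abs]

variable {H : Type*} [NormedAddCommGroup H] [InnerProductSpace ℂ H]

/-- The unit vector with argument `π / 2 + δ`. -/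
def hankelDirection (δ : ℝ) : ℂ := Complex.exp ((Real.pi / 2 + δ : ℝ) * Complex.I)

lemma isHankelDirection_hankelDirection {δ : ℝ} (hδ : 0 < δ) (hδ' : δ < Real.pi / 2) :
    IsHankelDirection (hankelDirection δ) := by
  refine ⟨Complex.norm_exp_ofReal_mul_I _, ?_, ?_⟩
  · rw [hankelDirection, Complex.exp_ofReal_mul_I_re]
    exact Real.cos_neg_of_pi_div_two_lt_of_lt (by linarith) (by linarith)
  · rw [hankelDirection, Complex.exp_ofReal_mul_I_im]
    exact Real.sin_pos_of_pos_of_lt_pi (by linarith) (by linarith)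

lemma arg_hankelDirection {δ : ℝ} (hδ : 0 < δ) (hδ' : δ < Real.pi / 2) :
    (hankelDirection δ).arg = Real.pi / 2 + δ := by
  rw [hankelDirection, Complex.exp_mul_I]
  exact Complex.arg_cos_add_sin_mul_I ⟨by linarith, by linarith⟩

/-- The Dunford integral for `exp(-z A)` over the Hankel contour of half-angle `π / 2 + δ`, for
`|arg z| < θ - 2 δ`. The factor `exp(ω₀ z)` undoes the shift in `shiftedResolvent`. -/
def sectorSemigroup (A : H →ₗ.[ℂ] H) (ω₀ δ : ℝ) (z : ℂ) : H →L[ℂ] H :=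
  Complex.exp (ω₀ * z) • dunfordIntegral (hankelDirection δ) (shiftedResolvent A ω₀) z

/-- The holomorphic semigroup `exp(-z A)` on `openSector θ ∪ {0}`; the contour opens less and less
as `z` approaches the boundary of the sector. -/
def holomorphicSemigroup (A : H →ₗ.[ℂ] H) (θ ω₀ : ℝ) (z : ℂ) : H →L[ℂ] H :=
  if z = 0 then 1 else sectorSemigroup A ω₀ ((θ - |z.arg|) / 4) z

variable [CompleteSpace H]

section

variable {θ ω₀ δ : ℝ} {A : H →ₗ.[ℂ] H} (hθ' : θ ≤ Real.pi / 2) (hA : HolomorphicClass θ ω₀ A)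
  (hδ : 0 < δ) (hδ' : 2 * δ < θ)
include hθ' hA hδ hδ'

/-- The data needed to apply the results on Dunford integrals. -/
lemma exists_sectorial_data : ∃ M : ℝ, 0 < M ∧
    IsSectorialResolvent (Real.pi / 2 + (θ - δ)) M (shiftedResolvent A ω₀) ∧
    IsHankelDirection (hankelDirection δ) ∧
    (hankelDirection δ).arg + (θ - 2 * δ) ≤ Real.pi / 2 + (θ - δ) ∧
    Real.pi / 2 + (θ - δ) ≤ Real.pi := by
  obtain ⟨M, hM, hG⟩ := hA.exists_isSectorialResolvent hδ (by linarith)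
  refine ⟨M, hM, hG, isHankelDirection_hankelDirection hδ (by linarith), ?_, by linarith⟩
  rw [arg_hankelDirection hδ (by linarith)]
  linarith

lemma hasDerivAt_sectorSemigroup {z : ℂ} (hz : z ∈ sector (θ - 2 * δ)) :
    HasDerivAt (sectorSemigroup A ω₀ δ) ((ω₀ : ℂ) • sectorSemigroup A ω₀ δ z +
      Complex.exp (ω₀ * z) • dunfordDeriv (hankelDirection δ) (shiftedResolvent A ω₀) z) z := by
  obtain ⟨M, hM, hG, he, hsum, hβ⟩ := exists_sectorial_data hθ' hA hδ hδ'
  have h1 : HasDerivAt (fun z : ℂ => Complex.exp (ω₀ * z)) (Complex.exp (ω₀ * z) * ω₀) z := by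
    simpa using ((hasDerivAt_id z).const_mul (ω₀ : ℂ)).cexp
  refine (h1.smul (hG.hasDerivAt_dunfordIntegral he hsum hβ (by linarith [Real.pi_pos])
    hz)).congr_deriv ?_
  rw [sectorSemigroup, smul_smul, add_comm, mul_comm]

lemma exists_norm_sectorSemigroup_le : ∃ C : ℝ, 1 ≤ C ∧ ∀ z ∈ sector (θ - 2 * δ),
    ‖sectorSemigroup A ω₀ δ z‖ ≤ C * Real.exp (|ω₀| * ‖z‖) := by
  obtain ⟨M, hM, hG, he, hsum, hβ⟩ := exists_sectorial_data hθ' hA hδ hδ'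
  refine ⟨max 1 (M / (hankelDirection δ).im * hankelConst (hankelDirection δ)), le_max_left _ _,
    fun z hz => ?_⟩
  rw [sectorSemigroup, norm_smul, mul_comm]
  have h1 := norm_exp_mul_le ω₀ z
  have h2 := (hG.norm_dunfordIntegral_le he hsum hβ hz).trans (le_max_right 1 _)
  gcongr

lemma tendsto_sectorSemigroup_mul_resolvent :
    Tendsto (fun z => sectorSemigroup A ω₀ δ z * shiftedResolvent A ω₀ 1)
      (𝓝[sector (θ - 2 * δ)] 0) (𝓝 (shiftedResolvent A ω₀ 1)) := by
  obtain ⟨M, hM, hG, he, hsum, hβ⟩ := exists_sectorial_data hθ' hA hδ hδ'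
  have h1 : (1 : ℂ) ∈ sector (Real.pi / 2 + (θ - δ)) := by
    simpa using ofReal_mem_sector (by linarith [Real.pi_pos]) one_pos
  have h2 : Tendsto (fun z => dunfordIntegral (hankelDirection δ) (shiftedResolvent A ω₀) z *
      shiftedResolvent A ω₀ 1) (𝓝[sector (θ - 2 * δ)] 0) (𝓝 (shiftedResolvent A ω₀ 1)) := by
    rw [tendsto_iff_norm_sub_tendsto_zero]
    refine squeeze_zero' (Eventually.of_forall fun _ => norm_nonneg _)
      (eventually_mem_nhdsWithin.mono fun z hz =>
        hG.norm_dunfordIntegral_mul_sub_le he hsum hβ hz h1) ?_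
    have : Tendsto (fun z : ℂ => ‖z‖) (𝓝[sector (θ - 2 * δ)] 0) (𝓝 0) :=
      (continuous_norm.tendsto' 0 0 norm_zero).mono_left nhdsWithin_le_nhds
    simpa using this.mul_const _
  have h3 : Tendsto (fun z : ℂ => Complex.exp (ω₀ * z)) (𝓝[sector (θ - 2 * δ)] 0) (𝓝 1) :=
    ((by fun_prop : Continuous fun z : ℂ => Complex.exp (ω₀ * z)).tendsto' 0 1
      (by simp)).mono_left nhdsWithin_le_nhds
  have h4 := h3.smul h2
  rw [one_smul] at h4
  exact h4.congr fun z => by rw [sectorSemigroup, smul_mul_assoc]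

/-- Factorization of the semigroup through the resolvent. -/
lemma exists_sectorSemigroup_eq_mul : ∃ C : ℝ, 0 ≤ C ∧ ∀ z ∈ sector (θ - 2 * δ), ∀ μ : ℝ, 0 < μ →
    ∃ L : H →L[ℂ] H, sectorSemigroup A ω₀ δ z = shiftedResolvent A ω₀ μ * L ∧
      ‖L‖ ≤ Real.exp (|ω₀| * ‖z‖) * (C * (μ + ‖z‖⁻¹)) := by
  obtain ⟨M, hM, hG, he, hsum, hβ⟩ := exists_sectorial_data hθ' hA hδ hδ'
  set e := hankelDirection δ
  have hc := he.hankelConst_nonneg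
  have him := he.im_pos
  refine ⟨max (M / e.im * hankelConst e) (M * hankelConst e), by positivity, fun z hz μ hμ => ?_⟩
  have hμs : (μ : ℂ) ∈ sector (Real.pi / 2 + (θ - δ)) :=
    ofReal_mem_sector (by linarith [Real.pi_pos]) hμ
  refine ⟨Complex.exp (ω₀ * z) • ((μ : ℂ) • dunfordIntegral e (shiftedResolvent A ω₀) z -
    dunfordDeriv e (shiftedResolvent A ω₀) z), ?_, ?_⟩
  · rw [mul_smul_comm, hG.mul_sub_dunfordDeriv he hsum hβ hz hμs, sectorSemigroup]
  · rw [norm_smul]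
    have h1 := norm_exp_mul_le ω₀ z
    have h2 := (hG.norm_dunfordIntegral_le he hsum hβ hz)
    have h3 := (hG.norm_dunfordDeriv_le he hsum hβ hz)
    have h4 : ‖(μ : ℂ) • dunfordIntegral e (shiftedResolvent A ω₀) z -
        dunfordDeriv e (shiftedResolvent A ω₀) z‖ ≤
        max (M / e.im * hankelConst e) (M * hankelConst e) * (μ + ‖z‖⁻¹) := by
      refine (norm_sub_le _ _).trans ?_
      rw [norm_smul, Complex.norm_real, Real.norm_of_nonneg hμ.le, mul_add]
      refine add_le_add ?_ (h3.trans ?_)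
      · rw [mul_comm]
        gcongr
        exact h2.trans (le_max_left _ _)
      · rw [div_eq_mul_inv, mul_right_comm]
        gcongr
        exact le_max_right _ _
    gcongr

variable {T : ℝ → H →L[ℂ] H} (hT : IsC0Semigroup T) (hAT : IsGenerator A T)
include hT hAT

lemma sectorSemigroup_ofReal {t : ℝ} (ht : 0 < t) : sectorSemigroup A ω₀ δ t = T t := by
  obtain ⟨M, hM, hG, he, hsum, hβ⟩ := exists_sectorial_data hθ' hA hδ hδ'
  have h1 : (1 : ℂ) ∈ sector (Real.pi / 2 + (θ - δ)) := by
    simpa using ofReal_mem_sector (by linarith [Real.pi_pos]) one_pos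
  have hs : ∀ s : ℝ, 0 < s → (s : ℂ) ∈ sector (θ - 2 * δ) := fun s hs =>
    ofReal_mem_sector (by linarith) hs
  refine (hAT.eq_of_hasDerivAt hT (hA.isResolventAt hδ (by linarith) h1)
    (U := fun s : ℝ => sectorSemigroup A ω₀ δ s)
    (U' := fun s : ℝ => (ω₀ : ℂ) • sectorSemigroup A ω₀ δ s +
      Complex.exp (ω₀ * s) • dunfordDeriv (hankelDirection δ) (shiftedResolvent A ω₀) s)
    (fun s hs0 => ((hasDerivAt_sectorSemigroup hθ' hA hδ hδ' (hs s hs0)).scomp s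
      Complex.ofRealCLM.hasDerivAt).congr_deriv (by simp))
    (fun s hs0 => ?_) (fun s hs0 => ?_) ?_ ht).symm
  · have h2 := hG.mul_sub_dunfordDeriv he hsum hβ (hs s hs0) h1
    rw [mul_sub, one_smul, sub_eq_iff_eq_add'] at h2
    simp only [sectorSemigroup, mul_add, mul_smul_comm, h2]
    module
  · exact (hG.commute_dunfordIntegral he hsum hβ (hs s hs0) h1).smul_right _
  · refine (tendsto_sectorSemigroup_mul_resolvent hθ' hA hδ hδ').comp
      (tendsto_nhdsWithin_iff.2 ⟨?_, eventually_mem_nhdsWithin.mono fun s hs0 => hs s hs0⟩)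
    exact (Complex.continuous_ofReal.tendsto' 0 0 Complex.ofReal_zero).mono_left nhdsWithin_le_nhds

/-- The Dunford integrals over different contours agree, as all of them extend `T`. -/
lemma holomorphicSemigroup_eq {z : ℂ} (hz : z ∈ sector (θ - 2 * δ)) :
    holomorphicSemigroup A θ ω₀ z = sectorSemigroup A ω₀ δ z := by
  rw [holomorphicSemigroup, if_neg hz.1]
  have harg := hz.2
  set δ' := (θ - |z.arg|) / 4 with hδ'_def
  have h1 : 0 < δ' := by rw [hδ'_def]; linarith
  have h2 : 2 * δ' < θ := by rw [hδ'_def]; linarith [abs_nonneg z.arg]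
  set η := min (θ - 2 * δ) (θ - 2 * δ') with hη_def
  have hη : 0 < η := lt_min (by linarith) (by linarith)
  have hη' : η ≤ Real.pi / 2 := (min_le_left _ _).trans (by linarith)
  have hsub : ∀ w ∈ openSector η, w ∈ sector (θ - 2 * δ) ∧ w ∈ sector (θ - 2 * δ') := by
    intro w hw
    rw [openSector_eq_sector hη'] at hw
    exact ⟨⟨hw.1, hw.2.trans_le (min_le_left _ _)⟩, ⟨hw.1, hw.2.trans_le (min_le_right _ _)⟩⟩
  refine eqOn_openSector_of_eq_ofReal hη hη' (fun w hw => ?_) (fun w hw => ?_) (fun t ht => ?_) ?_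
  · exact (hasDerivAt_sectorSemigroup hθ' hA h1 h2
      (hsub w hw).2).differentiableAt.differentiableWithinAt
  · exact (hasDerivAt_sectorSemigroup hθ' hA hδ hδ'
      (hsub w hw).1).differentiableAt.differentiableWithinAt
  · rw [sectorSemigroup_ofReal hθ' hA h1 h2 hT hAT ht,
      sectorSemigroup_ofReal hθ' hA hδ hδ' hT hAT ht]
  · rw [openSector_eq_sector hη']
    exact ⟨hz.1, lt_min harg (by rw [hδ'_def]; linarith)⟩

end

section

variable {θ ω₀ : ℝ} {A : H →ₗ.[ℂ] H} (hθ : 0 < θ) (hθ' : θ ≤ Real.pi / 2)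
  (hA : HolomorphicClass θ ω₀ A)
  {T : ℝ → H →L[ℂ] H} (hT : IsC0Semigroup T) (hAT : IsGenerator A T)
include hθ hθ' hA hT hAT

lemma holomorphicSemigroup_ofReal {t : ℝ} (ht : 0 ≤ t) :
    holomorphicSemigroup A θ ω₀ t = T t := by
  rcases ht.eq_or_lt with rfl | ht
  · rw [hT.map_zero]; simp [holomorphicSemigroup]
  · rw [holomorphicSemigroup_eq hθ' hA (δ := θ / 4) (by linarith) (by linarith) hT hAT
      (ofReal_mem_sector (by linarith) ht),
      sectorSemigroup_ofReal hθ' hA (by linarith) (by linarith) hT hAT ht]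

lemma differentiableOn_holomorphicSemigroup :
    DifferentiableOn ℂ (holomorphicSemigroup A θ ω₀) (openSector θ) := by
  intro z hz
  rw [openSector_eq_sector hθ'] at hz
  have harg := hz.2
  set δ := (θ - |z.arg|) / 4 with hδ_def
  have h1 : 0 < δ := by rw [hδ_def]; linarith
  have h2 : 2 * δ < θ := by rw [hδ_def]; linarith [abs_nonneg z.arg]
  have hz' : z ∈ sector (θ - 2 * δ) := ⟨hz.1, by rw [hδ_def]; linarith⟩
  refine DifferentiableAt.differentiableWithinAt ?_
  refine (hasDerivAt_sectorSemigroup hθ' hA h1 h2 hz').differentiableAt.congr_of_eventuallyEq ?_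
  filter_upwards [(isOpen_sector (by linarith [Real.pi_pos])).mem_nhds hz'] with w hw
  exact holomorphicSemigroup_eq hθ' hA h1 h2 hT hAT hw

lemma holomorphicSemigroup_add {z w : ℂ} (hz : z ∈ openSector θ) (hw : w ∈ openSector θ) :
    holomorphicSemigroup A θ ω₀ (z + w) =
      holomorphicSemigroup A θ ω₀ z * holomorphicSemigroup A θ ω₀ w := by
  have hd := differentiableOn_holomorphicSemigroup hθ hθ' hA hT hAT
  have hadd : ∀ v ∈ openSector θ,
      DifferentiableOn ℂ (fun z => holomorphicSemigroup A θ ω₀ (z + v)) (openSector θ) :=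
    fun v hv => hd.comp (by fun_prop) fun z hz => add_mem_openSector hθ hθ' hz hv
  -- the law for `w = t > 0` follows from the one for `z, w > 0`, and implies the general one
  have h1 : ∀ t : ℝ, 0 < t → Set.EqOn (fun z => holomorphicSemigroup A θ ω₀ (z + t))
      (fun z => holomorphicSemigroup A θ ω₀ z * holomorphicSemigroup A θ ω₀ t)
      (openSector θ) := by
    intro t ht
    refine eqOn_openSector_of_eq_ofReal hθ hθ' (hadd t (ofReal_mem_openSector hθ ht))
      (hd.mul_const _) fun s hs => ?_
    rw [← Complex.ofReal_add, holomorphicSemigroup_ofReal hθ hθ' hA hT hAT hs.le,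
      holomorphicSemigroup_ofReal hθ hθ' hA hT hAT ht.le,
      holomorphicSemigroup_ofReal hθ hθ' hA hT hAT (add_pos hs ht).le,
      hT.map_add _ _ hs.le ht.le]
  have h2 : Set.EqOn (fun w => holomorphicSemigroup A θ ω₀ (w + z))
      (fun w => holomorphicSemigroup A θ ω₀ z * holomorphicSemigroup A θ ω₀ w)
      (openSector θ) := by
    refine eqOn_openSector_of_eq_ofReal hθ hθ' (hadd z hz) (hd.const_mul _) fun t ht => ?_
    rw [add_comm]
    exact h1 t ht hz
  rw [add_comm]
  exact h2 hw

lemma holomorphicSemigroup_nsmul {z : ℂ} (hz : z ∈ openSector θ) (n : ℕ) :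
    holomorphicSemigroup A θ ω₀ (((n + 1 : ℕ) : ℂ) * z) =
      holomorphicSemigroup A θ ω₀ z ^ (n + 1) := by
  induction n with
  | zero => simp
  | succ n ih =>
    have h : (((n + 1 + 1 : ℕ) : ℂ)) * z = ((n + 1 : ℕ) : ℂ) * z + z := by push_cast; ring
    have h' : ((n + 1 : ℕ) : ℂ) * z ∈ openSector θ := by
      have := ofReal_mul_mem_openSector hz (t := ((n + 1 : ℕ) : ℝ)) (by positivity)
      rwa [Complex.ofReal_natCast] at this
    rw [h, holomorphicSemigroup_add hθ hθ' hA hT hAT h' hz, ih, ← pow_succ]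

omit hθ hθ' hA hT hAT [CompleteSpace H] in
lemma closedSector_subset {φ η : ℝ} (hφ : φ < η) : closedSector φ 0 ⊆ insert 0 (sector η) := by
  intro z hz
  rw [closedSector, Set.mem_ofPred_eq, Complex.ofReal_zero, sub_zero] at hz
  by_cases h : z = 0
  · exact .inl h
  · exact .inr ⟨h, hz.trans_lt hφ⟩

omit hθ in
lemma exists_norm_holomorphicSemigroup_le {φ : ℝ} (hφ : 0 < φ) (hφθ : φ < θ) :
    ∃ M : ℝ, 1 ≤ M ∧ ∀ z ∈ closedSector φ 0,
      ‖holomorphicSemigroup A θ ω₀ z‖ ≤ M * Real.exp (|ω₀| * ‖z‖) := by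
  have h1 : 0 < (θ - φ) / 4 := by linarith
  have h2 : 2 * ((θ - φ) / 4) < θ := by linarith
  obtain ⟨C, hC, hb⟩ := exists_norm_sectorSemigroup_le hθ' hA h1 h2
  refine ⟨C, hC, fun z hz => ?_⟩
  rcases closedSector_subset (η := θ - 2 * ((θ - φ) / 4)) (by linarith) hz with rfl | hz'
  · rw [holomorphicSemigroup, if_pos rfl, norm_zero, mul_zero, Real.exp_zero, mul_one]
    exact ContinuousLinearMap.norm_id_le.trans hC
  · rw [holomorphicSemigroup_eq hθ' hA h1 h2 hT hAT hz']
    exact hb z hz'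

omit hθ in
lemma tendsto_holomorphicSemigroup_apply {φ : ℝ} (hφ : 0 < φ) (hφθ : φ < θ) (x : H) :
    Tendsto (fun z => holomorphicSemigroup A θ ω₀ z x) (𝓝[closedSector φ 0] 0) (𝓝 x) := by
  have h1 : 0 < (θ - φ) / 4 := by linarith
  have h2 : 2 * ((θ - φ) / 4) < θ := by linarith
  set δ := (θ - φ) / 4 with hδ
  obtain ⟨M, hM, hb⟩ := exists_norm_holomorphicSemigroup_le hθ' hA hT hAT hφ hφθ
  have hrange : ∀ y, Tendsto (fun z => holomorphicSemigroup A θ ω₀ z (shiftedResolvent A ω₀ 1 y))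
      (𝓝[closedSector φ 0] 0) (𝓝 (shiftedResolvent A ω₀ 1 y)) := by
    intro y
    refine Tendsto.mono_left ?_ (nhdsWithin_mono _
      (closedSector_subset (η := θ - 2 * δ) (by rw [hδ]; linarith)))
    rw [nhdsWithin_insert, tendsto_sup]
    constructor
    · rw [tendsto_pure_left]
      intro s hs
      rw [holomorphicSemigroup, if_pos rfl]
      exact mem_of_mem_nhds hs
    · refine ((ContinuousLinearMap.apply ℂ H y).continuous.tendsto _ |>.comp
        (tendsto_sectorSemigroup_mul_resolvent hθ' hA h1 h2)).congr' ?_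
      filter_upwards [self_mem_nhdsWithin] with z hz
      rw [holomorphicSemigroup_eq hθ' hA h1 h2 hT hAT hz]
      rfl
  obtain ⟨C, -, hfac⟩ := exists_sectorSemigroup_eq_mul hθ' hA h1 h2
  rw [Metric.tendsto_nhds]
  intro ε hε
  set B := M * Real.exp |ω₀| with hB
  have hB0 : 0 < B := by positivity
  -- approximate `x` by `T t x`, which lies in the range of the resolvent
  obtain ⟨t, htx, ht⟩ := (((Metric.tendsto_nhds.1 (hT.tendsto_zero x)) (ε / (2 * (B + 1)))
    (by positivity)).and eventually_mem_nhdsWithin).exists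
  obtain ⟨L, hL, -⟩ := hfac t (ofReal_mem_sector (by linarith) ht) 1 one_pos
  rw [sectorSemigroup_ofReal hθ' hA h1 h2 hT hAT ht, Complex.ofReal_one] at hL
  have hy : T t x = shiftedResolvent A ω₀ 1 (L x) := by rw [hL]; rfl
  rw [hy] at htx
  set y := shiftedResolvent A ω₀ 1 (L x)
  have hball : ∀ᶠ z : ℂ in 𝓝[closedSector φ 0] 0, ‖z‖ < 1 :=
    nhdsWithin_le_nhds (continuous_norm.continuousAt.eventually_lt continuousAt_const (by simp))
  filter_upwards [(Metric.tendsto_nhds.1 (hrange (L x))) (ε / 2) (by positivity), hball,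
    self_mem_nhdsWithin] with z hz hz1 hzs
  rw [dist_eq_norm] at *
  have h3 : ‖holomorphicSemigroup A θ ω₀ z (x - y)‖ ≤ B * ‖y - x‖ := by
    rw [norm_sub_rev y x]
    refine ContinuousLinearMap.le_of_opNorm_le _ ((hb z hzs).trans ?_) _
    rw [hB]
    gcongr
    nlinarith [abs_nonneg ω₀]
  have h4 : holomorphicSemigroup A θ ω₀ z x - x = holomorphicSemigroup A θ ω₀ z (x - y) +
      (holomorphicSemigroup A θ ω₀ z y - y) + (y - x) := by
    rw [map_sub]; abel
  have h5 : (B + 1) * ‖y - x‖ < ε / 2 := by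
    rw [lt_div_iff₀ (by positivity)] at htx
    linarith
  rw [h4]
  calc _ ≤ ‖holomorphicSemigroup A θ ω₀ z (x - y)‖ +
        ‖holomorphicSemigroup A θ ω₀ z y - y‖ + ‖y - x‖ := norm_add₃_le
    _ < ε := by linarith

/-- A generator of class `ℋ(θ, ω₀)` generates a holomorphic semigroup. -/
theorem isQuasiBoundedHolomorphicSemigroup :
    IsQuasiBoundedHolomorphicSemigroup θ (holomorphicSemigroup A θ ω₀) where
  map_zero := if_pos rfl
  holomorphic := differentiableOn_holomorphicSemigroup hθ hθ' hA hT hAT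
  map_add _ hz _ hw := holomorphicSemigroup_add hθ hθ' hA hT hAT hz hw
  tendsto_zero _ hφ hφθ x := tendsto_holomorphicSemigroup_apply hθ' hA hT hAT hφ hφθ x
  quasiBounded _ hφ hφθ := by
    obtain ⟨M, hM, h⟩ := exists_norm_holomorphicSemigroup_le hθ' hA hT hAT hφ hφθ
    exact ⟨M, |ω₀|, hM, h⟩

end

end

section

/-! ### Trace norm estimate -/

lemma tsum_le_mul_tsum_of_antitone {f : ℕ → ℝ≥0∞} (hf : Antitone f) (n : ℕ) [NeZero n] :
    ∑' j, f j ≤ n * ∑' k, f (n * k) := by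
  rw [← (Nat.divModEquiv n).symm.tsum_eq, ENNReal.tsum_prod', ← ENNReal.tsum_mul_left]
  refine ENNReal.tsum_le_tsum fun k => ?_
  rw [tsum_fintype]
  refine (Finset.sum_le_card_nsmul _ _ (f (n * k)) fun i _ => hf ?_).trans_eq (by simp)
  rw [Nat.divModEquiv_symm_apply, mul_comm]
  exact Nat.le_add_right _ _

variable {H : Type*} [NormedAddCommGroup H] [InnerProductSpace ℂ H]

lemma isCompactOperator_mul_pow {K : H →L[ℂ] H} (hK : IsCompactOperator K) (L : H →L[ℂ] H)
    (n : ℕ) : IsCompactOperator ((K * L) ^ (n + 1) : H →L[ℂ] H) := by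
  rw [pow_succ', mul_assoc]
  exact hK.comp_clm (L * (K * L) ^ n)

variable [CompleteSpace H]

/-- If the approximation numbers of a compact `K` are at most `C₁` times those of `R` and
`‖K‖ ≤ C₂`, then the trace norm of a power `(K L)ⁿ` with `n ≥ p` is controlled by the `p`-th
Schatten sum of `R`. This replaces Hölder's inequality for Schatten norms, at the cost of a
factor `n`. -/
lemma schattenSum_one_mul_pow_le {K L R : H →L[ℂ] H} (hK : IsCompactOperator K)
    (hR : IsCompactOperator R) {C₁ C₂ p : ℝ} {n : ℕ} (hp : 0 < p) (hn : p ≤ n) (hC₁ : 0 ≤ C₁)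
    (hKR : ∀ k, approxNumber K k ≤ C₁ * approxNumber R k) (hKC : ‖K‖ ≤ C₂) :
    schattenSum 1 ((K * L) ^ n) ≤
      n * ENNReal.ofReal (‖L‖ ^ n * C₁ ^ p * C₂ ^ (n - p)) * schattenSum p R := by
  have hn0 : n ≠ 0 := by
    rintro rfl
    simp at hn
    linarith
  have : NeZero n := ⟨hn0⟩
  have hC₂ : 0 ≤ C₂ := (norm_nonneg _).trans hKC
  have hcomp : IsCompactOperator ((K * L) ^ n : H →L[ℂ] H) := by
    obtain ⟨m, rfl⟩ := Nat.exists_eq_succ_of_ne_zero hn0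
    exact isCompactOperator_mul_pow hK L m
  rw [schattenSum_eq_tsum_approxNumber hcomp one_pos, schattenSum_eq_tsum_approxNumber hR hp,
    mul_assoc, ← ENNReal.tsum_mul_left]
  simp_rw [Real.rpow_one]
  refine (tsum_le_mul_tsum_of_antitone
    (fun i j hij => ENNReal.ofReal_le_ofReal (approxNumber_antitone _ hij)) n).trans ?_
  gcongr with k
  rw [← ENNReal.ofReal_mul (by positivity)]
  refine ENNReal.ofReal_le_ofReal ?_
  have ha := approxNumber_nonneg K k
  have hb := approxNumber_nonneg R k
  have h1 : approxNumber K k ^ n ≤ C₁ ^ p * approxNumber R k ^ p * C₂ ^ (n - p) := by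
    rcases ha.eq_or_lt with h0 | h0
    · rw [← h0, zero_pow hn0]
      positivity
    · have h2 : approxNumber K k ^ n = approxNumber K k ^ p * approxNumber K k ^ (n - p) := by
        rw [← Real.rpow_add h0, add_sub_cancel, Real.rpow_natCast]
      rw [h2, ← Real.mul_rpow hC₁ hb]
      have := hKR k
      have := (approxNumber_le_norm K k).trans hKC
      have := sub_nonneg.2 hn
      gcongr
  calc approxNumber ((K * L) ^ n) (n * k) ≤ approxNumber (K * L) k ^ n := approxNumber_pow_le _ _ _
    _ ≤ (approxNumber K k * ‖L‖) ^ n := by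
      gcongr
      · exact approxNumber_nonneg _ _
      · exact approxNumber_mul_le_mul_norm _ _ _
    _ = ‖L‖ ^ n * approxNumber K k ^ n := by rw [mul_pow, mul_comm]
    _ ≤ ‖L‖ ^ n * (C₁ ^ p * approxNumber R k ^ p * C₂ ^ (n - p)) := by gcongr
    _ = _ := by ring

section

variable {θ ω₀ : ℝ} {A : H →ₗ.[ℂ] H} (hθ : 0 < θ) (hθ' : θ ≤ Real.pi / 2)
  (hA : HolomorphicClass θ ω₀ A)

include hθ' hA in
/-- The shifted resolvent at `μ ≥ 1` is a uniformly bounded multiple of any other resolvent. -/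
lemma exists_shiftedResolvent_eq_mul {δ : ℝ} (hδ : 0 < δ) (hδ' : 2 * δ < θ) {z₀ : ℂ}
    {R : H →L[ℂ] H} (hR : IsResolventAt A z₀ R) :
    ∃ C : ℝ, 0 ≤ C ∧ ∀ μ : ℝ, 1 ≤ μ → ‖shiftedResolvent A ω₀ μ‖ ≤ C / μ ∧
      ∃ D : H →L[ℂ] H, ‖D‖ ≤ C ∧ shiftedResolvent A ω₀ μ = D * R := by
  obtain ⟨M, hM, hG, -⟩ := exists_sectorial_data hθ' hA hδ hδ'
  have hC : M ≤ 1 + (1 + ‖(ω₀ : ℂ) + z₀‖) * M := by nlinarith [norm_nonneg ((ω₀ : ℂ) + z₀)]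
  refine ⟨1 + (1 + ‖(ω₀ : ℂ) + z₀‖) * M, by positivity, fun μ hμ => ?_⟩
  have hμ0 : 0 < μ := one_pos.trans_le hμ
  have hμs : (μ : ℂ) ∈ sector (Real.pi / 2 + (θ - δ)) :=
    ofReal_mem_sector (by linarith [Real.pi_pos]) hμ0
  have hGμ := hG.norm_le hμs
  rw [Complex.norm_real, Real.norm_of_nonneg hμ0.le] at hGμ
  refine ⟨hGμ.trans (by gcongr), 1 - (μ + (ω₀ + z₀) : ℂ) • shiftedResolvent A ω₀ μ, ?_, ?_⟩
  · refine (norm_sub_le _ _).trans (add_le_add ContinuousLinearMap.norm_id_le ?_)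
    rw [norm_smul]
    have h1 : ‖(μ + (ω₀ + z₀) : ℂ)‖ ≤ (1 + ‖(ω₀ : ℂ) + z₀‖) * μ := by
      refine (norm_add_le _ _).trans ?_
      rw [Complex.norm_real, Real.norm_of_nonneg hμ0.le, add_mul, one_mul]
      gcongr
      exact le_mul_of_one_le_right (norm_nonneg _) hμ
    calc _ ≤ (1 + ‖(ω₀ : ℂ) + z₀‖) * μ * (M / μ) := by gcongr
      _ = _ := by field_simp
  · have h := (hA.isResolventAt hδ (by linarith) hμs).sub_eq hR
    rw [sub_mul, one_mul, smul_mul_assoc]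
    refine (sub_eq_iff_eq_add.1 h).trans ?_
    module

variable {T : ℝ → H →L[ℂ] H} (hT : IsC0Semigroup T) (hAT : IsGenerator A T)
include hθ hθ' hA hT hAT

/-- For `n = ⌈p⌉`, the semigroup at `z` is the `n`-th power of `G(μ) L`, where `G` is the shifted
resolvent, `μ = max 1 (1 / |z|)` and `‖L‖ = O(μ)`, while `‖G(μ)‖ = O(1 / μ)`. -/
lemma exists_schattenSum_one_le {p : ℝ} (hp : 1 ≤ p) {z₀ : ℂ} {R : H →L[ℂ] H}
    (hR : IsResolventAt A z₀ R) (hRp : MemSchatten p R) {δ : ℝ} (hδ : 0 < δ)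
    (hδ' : 2 * δ < θ) :
    ∃ C b : ℝ, 0 ≤ C ∧ 0 ≤ b ∧ ∀ z ∈ sector (θ - 2 * δ),
      IsCompactOperator (holomorphicSemigroup A θ ω₀ z) ∧
      schattenSum 1 (holomorphicSemigroup A θ ω₀ z) ≤
        ENNReal.ofReal (C * Real.exp (b * ‖z‖) * max 1 ‖z‖⁻¹ ^ p) := by
  obtain ⟨C₁, hC₁, hres⟩ := exists_shiftedResolvent_eq_mul hθ' hA hδ hδ' hR
  obtain ⟨C₂, hC₂, hfac⟩ := exists_sectorSemigroup_eq_mul hθ' hA hδ hδ'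
  obtain ⟨hRc, hRfin⟩ := hRp
  have hp0 : 0 < p := one_pos.trans_le hp
  set n := ⌈p⌉₊ with hn
  have hn0 : 0 < n := Nat.ceil_pos.2 hp0
  have hpn : p ≤ n := Nat.le_ceil p
  have hn1 : (0 : ℝ) < n := by exact_mod_cast hn0
  set s₀ := (schattenSum p R).toReal with hs₀
  refine ⟨n * ((C₂ * (1 + n)) ^ n * C₁ ^ p * C₁ ^ (n - p)) * s₀, |ω₀|, by positivity,
    abs_nonneg _, fun z hz => ?_⟩
  have hz0 : 0 < ‖z‖ := norm_pos_iff.2 hz.1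
  set μ := max 1 ‖z‖⁻¹ with hμ
  have hμ1 : 1 ≤ μ := le_max_left _ _
  have hμ0 : 0 < μ := one_pos.trans_le hμ1
  -- the point `w = z / n`
  obtain ⟨w, hw, hwz⟩ : ∃ w ∈ sector (θ - 2 * δ), (n : ℂ) * w = z := by
    refine ⟨((n : ℝ)⁻¹ : ℝ) * z, ⟨mul_ne_zero (by exact_mod_cast (inv_pos.2 hn1).ne') hz.1, ?_⟩,
      ?_⟩
    · rw [Complex.arg_real_mul _ (inv_pos.2 hn1)]; exact hz.2
    · push_cast
      rw [mul_inv_cancel_left₀ (by exact_mod_cast hn1.ne')]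
  have hwn : n * ‖w‖ = ‖z‖ := by rw [← hwz, norm_mul, Complex.norm_natCast]
  have hw0 : 0 < ‖w‖ := norm_pos_iff.2 hw.1
  have hpow : holomorphicSemigroup A θ ω₀ z = sectorSemigroup A ω₀ δ w ^ n := by
    obtain ⟨m, hm⟩ := Nat.exists_eq_succ_of_ne_zero hn0.ne'
    have hwθ : w ∈ openSector θ := by
      rw [openSector_eq_sector hθ']; exact ⟨hw.1, hw.2.trans (by linarith)⟩
    rw [← hwz, ← holomorphicSemigroup_eq hθ' hA hδ hδ' hT hAT hw, hm]
    exact holomorphicSemigroup_nsmul hθ hθ' hA hT hAT hwθ m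
  obtain ⟨L, hL, hLn⟩ := hfac w hw μ hμ0
  obtain ⟨hGn, D, hD, hDR⟩ := hres μ hμ1
  have hKc : IsCompactOperator (shiftedResolvent A ω₀ μ) := by
    rw [hDR]; exact hRc.clm_comp D
  have hL' : ‖L‖ ≤ Real.exp (|ω₀| * ‖w‖) * (C₂ * (1 + n) * μ) := by
    refine hLn.trans ?_
    rw [mul_assoc C₂]
    gcongr
    have : ‖w‖⁻¹ = n * ‖z‖⁻¹ := by rw [← hwn]; field_simp
    rw [this, add_mul, one_mul]
    gcongr
    exact le_max_right _ _
  have hLp : ‖L‖ ^ n ≤ Real.exp (|ω₀| * ‖z‖) * (C₂ * (1 + n)) ^ n * μ ^ n := by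
    calc ‖L‖ ^ n ≤ (Real.exp (|ω₀| * ‖w‖) * (C₂ * (1 + n) * μ)) ^ n := by gcongr
      _ = Real.exp (n * (|ω₀| * ‖w‖)) * (C₂ * (1 + n)) ^ n * μ ^ n := by
        rw [mul_pow, ← Real.exp_nat_mul, mul_pow _ μ]; ring
      _ = _ := by rw [← hwn]; ring_nf
  rw [hpow, hL]
  constructor
  · obtain ⟨m, hm⟩ := Nat.exists_eq_succ_of_ne_zero hn0.ne'
    rw [hm]
    exact isCompactOperator_mul_pow hKc L m
  · refine (schattenSum_one_mul_pow_le (L := L) hKc hRc hp0 hpn hC₁ (fun k => ?_) hGn).trans ?_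
    · rw [hDR]
      exact (approxNumber_mul_le_norm_mul D R k).trans
        (mul_le_mul_of_nonneg_right hD (approxNumber_nonneg _ _))
    · rw [← ENNReal.ofReal_toReal hRfin.ne, ← ENNReal.ofReal_natCast,
        ← ENNReal.ofReal_mul (by positivity), ← ENNReal.ofReal_mul (by positivity)]
      refine ENNReal.ofReal_le_ofReal ?_
      have hμp : μ ^ n * (C₁ / μ) ^ ((n : ℝ) - p) = C₁ ^ ((n : ℝ) - p) * μ ^ p := by
        rw [Real.div_rpow hC₁ hμ0.le, Real.rpow_sub hμ0, Real.rpow_natCast]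
        have := Real.rpow_pos_of_pos hμ0 p
        field_simp
      calc n * (‖L‖ ^ n * C₁ ^ p * (C₁ / μ) ^ ((n : ℝ) - p)) * s₀
          ≤ n * (Real.exp (|ω₀| * ‖z‖) * (C₂ * (1 + n)) ^ n * μ ^ n * C₁ ^ p *
            (C₁ / μ) ^ ((n : ℝ) - p)) * s₀ := by gcongr
        _ = n * (Real.exp (|ω₀| * ‖z‖) * (C₂ * (1 + n)) ^ n * C₁ ^ p *
            (μ ^ n * (C₁ / μ) ^ ((n : ℝ) - p))) * s₀ := by ring
        _ = _ := by rw [hμp]; ring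

/-- The semigroup is of trace class on the open sector. -/
lemma memSchatten_one_holomorphicSemigroup {p : ℝ} (hp : 1 ≤ p) {z₀ : ℂ} {R : H →L[ℂ] H}
    (hR : IsResolventAt A z₀ R) (hRp : MemSchatten p R) {z : ℂ} (hz : z ∈ openSector θ) :
    MemSchatten 1 (holomorphicSemigroup A θ ω₀ z) := by
  rw [openSector_eq_sector hθ'] at hz
  have harg := hz.2
  obtain ⟨C, b, -, -, h⟩ := exists_schattenSum_one_le hθ hθ' hA hT hAT hp hR hRp
    (δ := (θ - |z.arg|) / 4) (by linarith) (by linarith [abs_nonneg z.arg])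
  obtain ⟨h1, h2⟩ := h z ⟨hz.1, by linarith⟩
  exact ⟨h1, h2.trans_lt ENNReal.ofReal_lt_top⟩

lemma schattenNorm_one_holomorphicSemigroup_isBigO {p : ℝ} (hp : 1 ≤ p) {z₀ : ℂ}
    {R : H →L[ℂ] H} (hR : IsResolventAt A z₀ R) (hRp : MemSchatten p R) {φ : ℝ} (hφ : 0 < φ)
    (hφθ : φ < θ) :
    (fun z : ℂ => schattenNorm 1 (holomorphicSemigroup A θ ω₀ z))
      =O[𝓝[closedSector φ 0 \ {0}] 0] (fun z : ℂ => ‖z‖ ^ (-p)) := by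
  obtain ⟨C, b, hC, hb, h⟩ := exists_schattenSum_one_le hθ hθ' hA hT hAT hp hR hRp
    (δ := (θ - φ) / 4) (by linarith) (by linarith)
  refine IsBigO.of_bound (C * Real.exp b) ?_
  have hball : ∀ᶠ z : ℂ in 𝓝[closedSector φ 0 \ {0}] 0, ‖z‖ < 1 :=
    nhdsWithin_le_nhds (continuous_norm.continuousAt.eventually_lt continuousAt_const (by simp))
  filter_upwards [self_mem_nhdsWithin, hball] with z hz hz1
  have hzs : z ∈ sector (θ - 2 * ((θ - φ) / 4)) :=
    (closedSector_subset (by linarith) hz.1).resolve_left hz.2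
  have hz0 : 0 < ‖z‖ := norm_pos_iff.2 hzs.1
  have h1 := (h z hzs).2
  rw [max_eq_right (one_le_inv₀ hz0 |>.2 hz1.le)] at h1
  have h2 := ENNReal.toReal_le_of_le_ofReal (by positivity) h1
  rw [schattenNorm, div_one, Real.rpow_one, Real.norm_of_nonneg ENNReal.toReal_nonneg,
    Real.norm_of_nonneg (by positivity), Real.rpow_neg hz0.le, ← Real.inv_rpow hz0.le]
  refine h2.trans ?_
  gcongr
  nlinarith

end

end

end

end GibbsSemigroup

theorem theorem5p11 {H : Type*} [NormedAddCommGroup H] [InnerProductSpace ℂ H] [CompleteSpace H]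
    [TopologicalSpace.SeparableSpace H]
    (θ ω₀ : ℝ) (hθ : 0 < θ) (hθ' : θ ≤ Real.pi / 2)
    (A : H →ₗ.[ℂ] H) (hA : GibbsSemigroup.HolomorphicClass θ ω₀ A)
    (T : ℝ → H →L[ℂ] H) (hT : GibbsSemigroup.IsC0Semigroup T)
    (hAT : GibbsSemigroup.IsGenerator A T)
    (p : ℝ) (hp : 1 ≤ p)
    (hR : ∃ (z : ℂ) (R : H →L[ℂ] H),
      GibbsSemigroup.IsResolventAt A z R ∧ GibbsSemigroup.MemSchatten p R) :
    ∃ U : ℂ → H →L[ℂ] H,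
      GibbsSemigroup.IsHolomorphicGibbsSemigroup θ U ∧
      (∀ t : ℝ, 0 ≤ t → U (t : ℂ) = T t) ∧
      ∀ φ : ℝ, 0 < φ → φ < θ →
        (fun z : ℂ => GibbsSemigroup.schattenNorm 1 (U z))
          =O[𝓝[GibbsSemigroup.closedSector φ 0 \ {0}] 0] (fun z : ℂ => ‖z‖ ^ (-p)) := by
  obtain ⟨z₀, R, hR, hRp⟩ := hR
  refine ⟨GibbsSemigroup.holomorphicSemigroup A θ ω₀,
    { toIsQuasiBoundedHolomorphicSemigroup :=
        GibbsSemigroup.isQuasiBoundedHolomorphicSemigroup hθ hθ' hA hT hAT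
      traceClass := fun z hz =>
        GibbsSemigroup.memSchatten_one_holomorphicSemigroup hθ hθ' hA hT hAT hp hR hRp hz },
    fun t ht => GibbsSemigroup.holomorphicSemigroup_ofReal hθ hθ' hA hT hAT ht,
    fun φ hφ hφθ => GibbsSemigroup.schattenNorm_one_holomorphicSemigroup_isBigO hθ hθ' hA hT hAT
      hp hR hRp hφ hφθ⟩
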